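/- **Conventions.** All graphs are finite, simple, connected and undirected; $\partial$ denotes path-length distance. A graph $\Gamma$ with vertex set $X$ and diameter $D$ is *distance-regular* if for all $0\le h,i,j\le D$ the number $p^h_{ij}=|\{z\in X:\partial(x,z)=i,\ \partial(y,z)=j\}|$ is the same for all $x,y\in X$ with $\partial(x,y)=h$. Put $c_i=p^i_{1,i-1}$ $(1\le i\le D)$, $a_i=p^i_{1,i}$ $(0\le i\le D)$, $b_i=p^i_{1,i+1}$ $(0\le i\le D-1)$. With ${j\brack 1}=1+q+\dots+q^{j-1}$, $\Gamma$ has *classical parameters* $(D,q,\alpha,\beta)$ if $c_i={i\brack 1}\bigl(1+\alpha{i-1\brack 1}\bigr)$ for $1\le i\le D$ and $b_i=\bigl({D\brack 1}-{i\brack 1}\bigr)\bigl(\beta-\alpha{i\brack 1}\bigr)$ for $0\le i\le D-1$; it is of *negative type* if it has classical parameters $(D,q,\alpha,\beta)$ with $q<-1$. It is a *near polygon* if $a_i=a_1c_i$ for $1\le i\le D-1$ and it has no induced subgraph $K_{1,1,2}$. Fix $x\in X$, and let $\Gamma_f$ be the (bipartite, connected) graph obtained from $\Gamma$ by deleting all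 edges $yz$ with $\partial(x,y)=\partial(x,z)$. Let $\varepsilon$ be the eccentricity of $x$ in $\Gamma_f$, $V=\mathbb C^X$, and let $A_f$ be the adjacency matrix of $\Gamma_f$. Let $E_i^*$ be the diagonal matrix whose $(y,y)$-entry is $1$ if $y$ is at distance $i$ from $x$ and $0$ otherwise, and put $L=\sum_{i=1}^{\varepsilon}E^*_{i-1}A_fE^*_i$ and $R=\sum_{i=0}^{\varepsilon-1}E^*_{i+1}A_fE^*_i$. A *parameter matrix* is a tridiagonal complex matrix $U=(e_{ij})_{1\le i,j\le\varepsilon}$ such that (i) $e_{ii}=1$ for all $i$; (ii) either $e_{i,i-1}\ne0$ for all $2\le i\le\varepsilon$, or $e_{i-1,i}\neq0$ for all $2\le i\le\varepsilon$; (iii) the principal submatrix $(e_{ij})_{s\le i,j\le t}$ is nonsingular for all $1\le s\le t\le\varepsilon$. Write $e_i^-=e_{i,i-1}$ and $e_i^+=e_{i,i+1}$, with $e_1^-=e_\varepsilon^+=0$. The graph $\Gamma$ *supports a uniform structure with respect to $x$* if there are a parameter matrix $U$ and a vector $(f_1,\dots,f_\varepsilon)\in\mathbb C^\varepsilon$ such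 that $$e_i^-RL^2+LRL+e_i^+L^2R=f_iL\quad\text{on } E_i^*V\qquad(1\le i\le\varepsilon).$$ **Theorem 6.3 (nonzero).** Let $\Gamma$ be a distance-regular graph with diameter $D\ge3$ that is of negative type, has $a_1\neq0$, and is not a near polygon. Then for every vertex $x$ of $\Gamma$, the graph $\Gamma$ does not support a uniform structure with respect to $x$. -/

import Mathlib

namespace SimpleGraph

/-! ### Distance-regular graphs, classical parameters, near polygons -/

section DistanceRegular

variable {X : Type*} [Fintype X]

open Classical in
/-- The number `|Γ_i(x) ∩ Γ_j(y)|` of vertices at distance `i` from `x` and `j` from `y`. -/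
noncomputable def sphereInterCard (Γ : SimpleGraph X) (i j : ℕ) (x y : X) : ℕ :=
  (Finset.univ.filter fun z : X => Γ.dist x z = i ∧ Γ.dist y z = j).card

/-- A (connected) graph of diameter `D` is distance-regular if for all `0 ≤ h, i, j ≤ D` the number
`|Γ_i(x) ∩ Γ_j(y)|` is the same for all pairs of vertices `x, y` at distance `h`. -/
def IsDistanceRegular (Γ : SimpleGraph X) : Prop :=
  Γ.Connected ∧ ∀ h i j : ℕ, h ≤ Γ.diam → i ≤ Γ.diam → j ≤ Γ.diam →
    ∃ p : ℕ, ∀ x y : X, Γ.dist x y = h → Γ.sphereInterCard i j x y = p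

open Classical in
/-- The intersection number `p^h_{ij}` of a distance-regular graph: the value of
`|Γ_i(x) ∩ Γ_j(y)|` at some (equivalently, any) pair `x, y` at distance `h`. -/
noncomputable def intersectionNumber (Γ : SimpleGraph X) (h i j : ℕ) : ℕ :=
  if hp : ∃ p : X × X, Γ.dist p.1 p.2 = h then
    Γ.sphereInterCard i j hp.choose.1 hp.choose.2
  else 0

theorem IsDistanceRegular.sphereInterCard_eq {Γ : SimpleGraph X} (hΓ : Γ.IsDistanceRegular)
    {h i j : ℕ} (hh : h ≤ Γ.diam) (hi : i ≤ Γ.diam) (hj : j ≤ Γ.diam) {x y : X}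
    (hxy : Γ.dist x y = h) : Γ.sphereInterCard i j x y = Γ.intersectionNumber h i j := by
  obtain ⟨p, hp⟩ := hΓ.2 h i j hh hi hj
  have hex : ∃ q : X × X, Γ.dist q.1 q.2 = h := ⟨(x, y), hxy⟩
  rw [intersectionNumber, dif_pos hex, hp x y hxy, hp _ _ hex.choose_spec]

/-- `c_i = p^i_{1,i-1}`, for `1 ≤ i ≤ D`. -/
noncomputable def drgC (Γ : SimpleGraph X) (i : ℕ) : ℕ := Γ.intersectionNumber i 1 (i - 1)

/-- `a_i = p^i_{1,i}`, for `0 ≤ i ≤ D`. -/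
noncomputable def drgA (Γ : SimpleGraph X) (i : ℕ) : ℕ := Γ.intersectionNumber i 1 i

/-- `b_i = p^i_{1,i+1}`, for `0 ≤ i ≤ D - 1`. -/
noncomputable def drgB (Γ : SimpleGraph X) (i : ℕ) : ℕ := Γ.intersectionNumber i 1 (i + 1)

/-- The Gaussian coefficient `[j choose 1] = 1 + q + ⋯ + q^(j-1)` with base `q`. -/
def gaussOne (q : ℝ) (j : ℕ) : ℝ := ∑ k ∈ Finset.range j, q ^ k

/-- The intersection numbers of `Γ`, of diameter `D`, are given by the classical parameters
`(D, q, α, β)`. -/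
def HasClassicalParameters (Γ : SimpleGraph X) (D : ℕ) (q α β : ℝ) : Prop :=
  Γ.IsDistanceRegular ∧ Γ.diam = D ∧
    (∀ i : ℕ, 1 ≤ i → i ≤ D →
      (Γ.drgC i : ℝ) = gaussOne q i * (1 + α * gaussOne q (i - 1))) ∧
    (∀ i : ℕ, i + 1 ≤ D →
      (Γ.drgB i : ℝ) = (gaussOne q D - gaussOne q i) * (β - α * gaussOne q i))

/-- `Γ` is of negative type: it has classical parameters `(D, q, α, β)` with `q < -1`. -/
def IsOfNegativeType (Γ : SimpleGraph X) : Prop :=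
  ∃ q α β : ℝ, q < -1 ∧ Γ.HasClassicalParameters Γ.diam q α β

/-- The complete multipartite graph `K_{1,1,2}`. -/
def K112 : SimpleGraph (Σ i : Fin 3, Fin (![1, 1, 2] i)) :=
  completeMultipartiteGraph fun i : Fin 3 => Fin (![1, 1, 2] i)

/-- A distance-regular graph of diameter `D` is a near polygon if `a_i = a_1 c_i` for
`1 ≤ i ≤ D - 1` and it has no induced subgraph `K_{1,1,2}`. -/
def IsNearPolygon (Γ : SimpleGraph X) : Prop :=
  Γ.IsDistanceRegular ∧
    (∀ i : ℕ, 1 ≤ i → i + 1 ≤ Γ.diam → Γ.drgA i = Γ.drgA 1 * Γ.drgC i) ∧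
    ¬ K112.IsIndContained Γ

end DistanceRegular

/-! ### Uniform structures -/

section Uniform

variable {X : Type*} [Fintype X]

/-- The eccentricity `ε(x)` of a vertex (a natural number; meaningful for finite connected
graphs). -/
noncomputable def eccNat (Γ : SimpleGraph X) (x : X) : ℕ := (Γ.eccent x).toNat

open Classical in
/-- The `i`-th dual idempotent `E*_i` with respect to `x`: the diagonal matrix with `(y, y)`-entry
`1` if `∂(x, y) = i` and `0` otherwise. -/
noncomputable def dualIdempotent (Γ : SimpleGraph X) (x : X) (i : ℕ) : Matrix X X ℂ :=
  Matrix.diagonal fun y => if Γ.dist x y = i then 1 else 0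

open Classical in
/-- The lowering matrix `L = ∑_{i=1}^{ε} E*_{i-1} A E*_i` with respect to `x`. -/
noncomputable def loweringMatrix (Γ : SimpleGraph X) (x : X) : Matrix X X ℂ :=
  ∑ i ∈ Finset.Icc 1 (Γ.eccNat x),
    Γ.dualIdempotent x (i - 1) * Γ.adjMatrix ℂ * Γ.dualIdempotent x i

open Classical in
/-- The raising matrix `R = ∑_{i=0}^{ε-1} E*_{i+1} A E*_i` with respect to `x`. -/
noncomputable def raisingMatrix (Γ : SimpleGraph X) (x : X) : Matrix X X ℂ :=
  ∑ i ∈ Finset.range (Γ.eccNat x),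
    Γ.dualIdempotent x (i + 1) * Γ.adjMatrix ℂ * Γ.dualIdempotent x i

/-- `U = (e_{ij})_{1 ≤ i, j ≤ n}` is a parameter matrix. Only the entries of `U` with indices in
`{1, …, n}` are used. -/
structure IsParameterMatrix (n : ℕ) (U : Matrix ℕ ℕ ℂ) : Prop where
  tridiagonal : ∀ i ∈ Finset.Icc 1 n, ∀ j ∈ Finset.Icc 1 n, (i + 1 < j ∨ j + 1 < i) → U i j = 0
  diag : ∀ i ∈ Finset.Icc 1 n, U i i = 1
  offDiag : (∀ i ∈ Finset.Icc 2 n, U i (i - 1) ≠ 0) ∨ (∀ i ∈ Finset.Icc 2 n, U (i - 1) i ≠ 0)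
  nonsingular : ∀ s t : ℕ, 1 ≤ s → s ≤ t → t ≤ n →
    (U.submatrix (fun i : Finset.Icc s t => (i : ℕ)) (fun j : Finset.Icc s t => (j : ℕ))).det ≠ 0

/-- `e^-_i = e_{i,i-1}` for `i ≥ 2`, and `e^-_1 = 0`. -/
noncomputable def eMinus (U : Matrix ℕ ℕ ℂ) (i : ℕ) : ℂ := if 2 ≤ i then U i (i - 1) else 0

/-- `e^+_i = e_{i,i+1}` for `i ≤ n - 1`, and `e^+_n = 0`. -/
noncomputable def ePlus (n : ℕ) (U : Matrix ℕ ℕ ℂ) (i : ℕ) : ℂ :=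
  if i + 1 ≤ n then U i (i + 1) else 0

/-- `(U, f)` is a uniform structure of the (bipartite) graph `Γ` with respect to `x`: `U` is a
parameter matrix of size `ε = ε(x)`, `f = (f_1, …, f_ε)`, and
`e^-_i R L² + L R L + e^+_i L² R = f_i L` holds on `E*_i V` for `1 ≤ i ≤ ε`. -/
def IsUniformStructure (Γ : SimpleGraph X) (x : X) (U : Matrix ℕ ℕ ℂ) (f : ℕ → ℂ) : Prop :=
  IsParameterMatrix (Γ.eccNat x) U ∧
    ∀ i ∈ Finset.Icc 1 (Γ.eccNat x), ∀ v : X → ℂ,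
      let L := Γ.loweringMatrix x
      let R := Γ.raisingMatrix x
      Matrix.mulVec
          (eMinus U i • (R * (L * L)) + L * R * L + ePlus (Γ.eccNat x) U i • (L * L * R))
          (Matrix.mulVec (Γ.dualIdempotent x i) v) =
        Matrix.mulVec (f i • L) (Matrix.mulVec (Γ.dualIdempotent x i) v)

/-- `Γ` admits a uniform structure with respect to `x`. -/
def HasUniformStructure (Γ : SimpleGraph X) (x : X) : Prop :=
  ∃ (U : Matrix ℕ ℕ ℂ) (f : ℕ → ℂ), Γ.IsUniformStructure x U f

/-- The graph `Γ_f = Γ_f(x)`: delete from `Γ` every edge `yz` with `∂(x, y) = ∂(x, z)`. -/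
def flatDeleted (Γ : SimpleGraph X) (x : X) : SimpleGraph X where
  Adj y z := Γ.Adj y z ∧ Γ.dist x y ≠ Γ.dist x z
  symm := ⟨fun _ _ h => ⟨h.1.symm, h.2.symm⟩⟩
  loopless := ⟨fun _ h => h.2 rfl⟩

/-- `Γ` supports a uniform structure with respect to `x` if `Γ_f(x)` admits one. -/
def SupportsUniformStructure (Γ : SimpleGraph X) (x : X) : Prop :=
  (Γ.flatDeleted x).HasUniformStructure x

end Uniform

end SimpleGraph

/-!
Because of the classical parameters, `f i = η + q⁻ⁱ` is a cosine sequence for a suitable `η`, so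
the matrix `F = (f (∂(y, z)))` is a positive multiple of an orthogonal projection. For vertices
`y`, `z` consider Terwilliger's vector `∑ e_w - ∑ e_w - r (e_y - e_z)`, the sums being over
`w ∈ Γ₁(y) ∩ Γ₂(z)` and `w ∈ Γ₂(y) ∩ Γ₁(z)`. The squared lengths of these vectors with respect to
`F` add up to zero, so `F` kills each of them. At distance `3` this equates `q` times a number of
kites with a number of parallelograms, and `q < 0` makes both vanish; so there are no kites of
length `2` or `3` and no parallelograms of length `3`.

Hence `Γ(x)` is a disjoint union of cliques of size `a₁ + 1`. The difference `v` of the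
characteristic vectors of two of them is an eigenvector of `LR` with `Lv = 0`, so if `e₂⁺ ≠ 0`, the
relation at `i = 2` makes `LR²v` a multiple of `Rv`. As `Γ` is not a near polygon, `a₂ ≠ a₁c₂`, and
some `z ∈ Γ₂(x)` has one clique entirely at distance `2` and another entirely at distance `3`; then
`(Rv)(z) = 0 ≠ (LR²v)(z)`. So `e₂⁺ = 0`. Comparing the entries of the relation at two kinds of
`s ∈ Γ(x)`, the second of which exists because `a₁ ≠ 0`, gives
`e₂⁻c₂ + (c₂ - 1)c₂ = 0 = e₂⁻c₂ + (c₂ - 1)²`. Hence `e₂⁻ = 0` as well, which contradicts the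
condition on the off-diagonal entries of `U`.
-/

namespace DistanceRegularGraph

open SimpleGraph Finset Matrix

section Distances

variable {X : Type*} {Γ : SimpleGraph X}

theorem dist_trichotomy (hc : Γ.Connected) {x z : X} (y : X) (h : Γ.dist x z = 1) :
    Γ.dist z y + 1 = Γ.dist x y ∨ Γ.dist z y = Γ.dist x y ∨ Γ.dist z y = Γ.dist x y + 1 := by
  have h₁ := hc.dist_triangle (u := x) (v := z) (w := y)
  have h₂ := hc.dist_triangle (u := z) (v := x) (w := y)
  rw [dist_comm (u := z) (v := x)] at h₂
  lia

theorem dist_mem_of_dist_eq_one (hc : Γ.Connected) {x y w : X} {m : ℕ} (hxy : Γ.dist x y = 1)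
    (hxw : Γ.dist x w = m + 1) : m ≤ Γ.dist y w ∧ Γ.dist y w ≤ m + 2 := by
  have := dist_trichotomy hc w hxy
  lia

theorem exists_dist_eq_of_le_dist (hc : Γ.Connected) {x y : X} {i : ℕ} (hi : i ≤ Γ.dist x y) :
    ∃ z, Γ.dist x z = i ∧ Γ.dist z y + i = Γ.dist x y := by
  obtain ⟨p, hp⟩ := hc.exists_walk_length_eq_dist x y
  have h₁ : Γ.dist x (p.getVert i) ≤ i := (dist_le (p.take i)).trans (by simp [Walk.take_length])
  have h₂ : Γ.dist (p.getVert i) y ≤ Γ.dist x y - i :=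
    (dist_le (p.drop i)).trans (by simp [Walk.drop_length, hp])
  have h₃ := hc.dist_triangle (u := x) (v := p.getVert i) (w := y)
  exact ⟨p.getVert i, by lia⟩

theorem card_filter_dist_eq_zero (hc : Γ.Connected) {s : Finset X} {x : X} (hx : x ∈ s) :
    #{w ∈ s | Γ.dist x w = 0} = 1 := by
  refine card_eq_one.2 ⟨x, eq_singleton_iff_unique_mem.2 ⟨by simp [hx], fun w hw => ?_⟩⟩
  exact ((hc.dist_eq_zero_iff).1 (mem_filter.1 hw).2).symm

end Distances

section IntersectionNumbers

variable {X : Type*} [Fintype X] {Γ : SimpleGraph X}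

/-- The sphere `Γ_i(x)` as a finset. -/
noncomputable def sphere (Γ : SimpleGraph X) (x : X) (i : ℕ) : Finset X := {z | Γ.dist x z = i}

/-- The intersection `Γ_i(x) ∩ Γ_j(y)` of two spheres as a finset; its cardinality is
`SimpleGraph.sphereInterCard`. -/
noncomputable def sphereInter (Γ : SimpleGraph X) (i j : ℕ) (x y : X) : Finset X :=
  {z | Γ.dist x z = i ∧ Γ.dist y z = j}

@[simp]
theorem mem_sphere {x z : X} {i : ℕ} : z ∈ sphere Γ x i ↔ Γ.dist x z = i := by simp [sphere]

@[simp]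
theorem mem_sphereInter {i j : ℕ} {x y z : X} :
    z ∈ sphereInter Γ i j x y ↔ Γ.dist x z = i ∧ Γ.dist y z = j := by simp [sphereInter]

theorem sphereInter_comm (i j : ℕ) (x y : X) : sphereInter Γ i j x y = sphereInter Γ j i y x := by
  ext z
  simp [and_comm]

theorem dist_le_diam (hr : Γ.IsDistanceRegular) (x y : X) : Γ.dist x y ≤ Γ.diam :=
  have : Nonempty X := ⟨x⟩
  SimpleGraph.dist_le_diam (connected_iff_ediam_ne_top.1 hr.1)

theorem card_sphereInter (hr : Γ.IsDistanceRegular) (i j : ℕ) (x y : X) :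
    #(sphereInter Γ i j x y) = Γ.intersectionNumber (Γ.dist x y) i j := by
  by_cases hij : i ≤ Γ.diam ∧ j ≤ Γ.diam
  · exact hr.sphereInterCard_eq (dist_le_diam hr x y) hij.1 hij.2 rfl
  · have hempty (u v : X) : #(sphereInter Γ i j u v) = 0 := by
      refine card_eq_zero.2 (eq_empty_of_forall_notMem fun z hz => hij ?_)
      obtain ⟨hu, hv⟩ := mem_sphereInter.1 hz
      exact ⟨hu ▸ dist_le_diam hr u z, hv ▸ dist_le_diam hr v z⟩
    have hex : ∃ p : X × X, Γ.dist p.1 p.2 = Γ.dist x y := ⟨(x, y), rfl⟩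
    rw [hempty, intersectionNumber, dif_pos hex]
    exact (hempty _ _).symm

theorem card_sphere (hr : Γ.IsDistanceRegular) (x : X) (i : ℕ) :
    #(sphere Γ x i) = Γ.intersectionNumber 0 i i := by
  rw [← dist_self (G := Γ) (v := x), ← card_sphereInter hr]
  congr 1
  ext z
  simp

theorem card_sphere_one (hr : Γ.IsDistanceRegular) (x : X) : #(sphere Γ x 1) = Γ.drgB 0 :=
  card_sphere hr x 1

theorem card_sphereInter_pred (hr : Γ.IsDistanceRegular) {i j : ℕ} {x y : X}
    (hij : j = i + 1) (h : Γ.dist x y = j) : #(sphereInter Γ 1 i x y) = Γ.drgC j := by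
  rw [card_sphereInter hr, h, hij, drgC, Nat.add_sub_cancel]

theorem card_sphereInter_self (hr : Γ.IsDistanceRegular) {i : ℕ} {x y : X}
    (h : Γ.dist x y = i) : #(sphereInter Γ 1 i x y) = Γ.drgA i := by
  rw [card_sphereInter hr, h, drgA]

theorem card_sphereInter_succ (hr : Γ.IsDistanceRegular) {i j : ℕ} {x y : X}
    (hij : j = i + 1) (h : Γ.dist x y = i) : #(sphereInter Γ 1 j x y) = Γ.drgB i := by
  rw [card_sphereInter hr, h, hij, drgB]

theorem exists_dist_eq (hr : Γ.IsDistanceRegular) (x : X) {i : ℕ} (hi : i ≤ Γ.diam) :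
    ∃ y, Γ.dist x y = i := by
  have : Nonempty X := ⟨x⟩
  obtain ⟨u, v, huv⟩ := Γ.exists_dist_eq_diam
  obtain ⟨w, hw, -⟩ := exists_dist_eq_of_le_dist hr.1 (x := u) (y := v) (i := i) (by lia)
  have hpos : 0 < #(sphere Γ x i) := by
    rw [card_sphere hr, ← card_sphere hr u]
    exact card_pos.2 ⟨w, mem_sphere.2 hw⟩
  obtain ⟨y, hy⟩ := card_pos.1 hpos
  exact ⟨y, mem_sphere.1 hy⟩

theorem drgB_pos (hr : Γ.IsDistanceRegular) {i : ℕ} (hi : i < Γ.diam) : 0 < Γ.drgB i := by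
  obtain ⟨x⟩ := hr.1.nonempty
  obtain ⟨w, hw⟩ := exists_dist_eq hr x hi
  obtain ⟨v, hv, hvw⟩ := exists_dist_eq_of_le_dist hr.1 (x := x) (y := w) (i := i) (by lia)
  rw [← card_sphereInter_succ hr rfl (x := v) (y := x) (by rw [dist_comm, hv])]
  exact card_pos.2 ⟨w, mem_sphereInter.2 ⟨by lia, hw⟩⟩

theorem drgC_pos (hr : Γ.IsDistanceRegular) {i : ℕ} (hi : 1 ≤ i) (hiD : i ≤ Γ.diam) :
    0 < Γ.drgC i := by
  obtain ⟨x⟩ := hr.1.nonempty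
  obtain ⟨y, hy⟩ := exists_dist_eq hr x hiD
  obtain ⟨z, hz, hzy⟩ := exists_dist_eq_of_le_dist hr.1 (x := x) (y := y) (i := 1) (by lia)
  rw [← card_sphereInter_pred hr (i := i - 1) (by lia) hy]
  exact card_pos.2 ⟨z, mem_sphereInter.2 ⟨hz, by rw [dist_comm]; lia⟩⟩

theorem exists_dist_succ (hr : Γ.IsDistanceRegular) {x y : X} (h : Γ.dist x y < Γ.diam) :
    ∃ z, Γ.dist y z = 1 ∧ Γ.dist x z = Γ.dist x y + 1 := by
  have hpos := drgB_pos hr h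
  rw [← card_sphereInter_succ hr rfl (dist_comm (u := y) (v := x))] at hpos
  obtain ⟨z, hz⟩ := card_pos.1 hpos
  exact ⟨z, mem_sphereInter.1 hz⟩

theorem drgC_zero (hr : Γ.IsDistanceRegular) : Γ.drgC 0 = 0 := by
  obtain ⟨x⟩ := hr.1.nonempty
  have hcard := card_sphereInter hr 1 0 x x
  rw [dist_self] at hcard
  refine hcard.symm.trans (card_eq_zero.2 (eq_empty_of_forall_notMem fun z hz => ?_))
  have := mem_sphereInter.1 hz
  lia

theorem drgB_diam (hr : Γ.IsDistanceRegular) : Γ.drgB Γ.diam = 0 := by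
  have : Nonempty X := hr.1.nonempty
  obtain ⟨x, y, h⟩ := Γ.exists_dist_eq_diam
  rw [← card_sphereInter_succ hr rfl h]
  refine card_eq_zero.2 (eq_empty_of_forall_notMem fun z hz => ?_)
  have := dist_le_diam hr y z
  have := mem_sphereInter.1 hz
  lia

theorem sum_comp_eq_sum_Icc {ι M : Type*} [AddCommMonoid M] {s : Finset ι} {e : ι → ℕ} {m n : ℕ}
    (h : ∀ i ∈ s, m ≤ e i ∧ e i ≤ n) (g : ℕ → M) :
    ∑ i ∈ s, g (e i) = ∑ k ∈ Icc m n, #{i ∈ s | e i = k} • g k := by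
  rw [← sum_fiberwise_of_maps_to fun i hi => mem_Icc.2 (h i hi)]
  refine sum_congr rfl fun k _ => ?_
  rw [sum_congr rfl fun i hi => by rw [(mem_filter.1 hi).2], sum_const]

theorem sum_Icc_three {M : Type*} [AddCommMonoid M] (m : ℕ) (g : ℕ → M) :
    ∑ k ∈ Icc m (m + 2), g k = g m + g (m + 1) + g (m + 2) := by
  rw [sum_Icc_succ_top (by lia), sum_Icc_succ_top (by lia), Icc_self, sum_singleton]

theorem sum_sphere_one {M : Type*} [AddCommMonoid M] (hr : Γ.IsDistanceRegular) (g : ℕ → M)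
    (x y : X) : ∑ z ∈ sphere Γ x 1, g (Γ.dist y z) = Γ.drgC (Γ.dist x y) • g (Γ.dist x y - 1) +
      Γ.drgA (Γ.dist x y) • g (Γ.dist x y) + Γ.drgB (Γ.dist x y) • g (Γ.dist x y + 1) := by
  have hfiber (k : ℕ) : #{z ∈ sphere Γ x 1 | Γ.dist y z = k} =
      Γ.intersectionNumber (Γ.dist x y) 1 k := by
    rw [← card_sphereInter hr]
    congr 1
    ext z
    simp
  have hbound : ∀ z ∈ sphere Γ x 1,
      Γ.dist x y - 1 ≤ Γ.dist y z ∧ Γ.dist y z ≤ Γ.dist x y + 1 := by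
    intro z hz
    rw [dist_comm (u := y)]
    rcases dist_trichotomy hr.1 y (mem_sphere.1 hz) with h | h | h <;> lia
  rw [sum_comp_eq_sum_Icc hbound]
  simp only [hfiber]
  obtain h0 | ⟨i, hi⟩ : Γ.dist x y = 0 ∨ ∃ i, Γ.dist x y = i + 1 := by
    rcases Γ.dist x y with _ | i <;> simp
  · have hIcc : Icc 0 1 = {0, 1} := rfl
    simp [h0, hIcc, drgC_zero hr, drgA, drgB]
  · rw [hi, Nat.add_sub_cancel, sum_Icc_three]
    simp only [drgC, drgA, drgB, Nat.add_sub_cancel]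

theorem drgC_add_drgA_add_drgB (hr : Γ.IsDistanceRegular) {i : ℕ} (hi : i ≤ Γ.diam) :
    Γ.drgC i + Γ.drgA i + Γ.drgB i = Γ.drgB 0 := by
  obtain ⟨x⟩ := hr.1.nonempty
  obtain ⟨y, rfl⟩ := exists_dist_eq hr x hi
  have h := sum_sphere_one hr (fun _ => 1) x y
  rw [← card_sphere_one hr x, card_eq_sum_ones, h]
  simp

end IntersectionNumbers

section RadialMatrices

variable {X : Type*} {Γ : SimpleGraph X}

/-- The matrix whose `(y, z)`-entry is `f (∂(y, z))`. For a distance-regular graph these matrices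
are the elements of the Bose–Mesner algebra. -/
noncomputable def radialMatrix (Γ : SimpleGraph X) (f : ℕ → ℝ) : Matrix X X ℝ :=
  of fun y z => f (Γ.dist y z)

/-- The distance matrix `A_i`. -/
noncomputable def distMatrix (Γ : SimpleGraph X) (i : ℕ) : Matrix X X ℝ :=
  radialMatrix Γ (Pi.single i 1)

theorem radialMatrix_apply (f : ℕ → ℝ) (y z : X) : radialMatrix Γ f y z = f (Γ.dist y z) := rfl

theorem distMatrix_apply (i : ℕ) (y z : X) :
    distMatrix Γ i y z = if Γ.dist y z = i then 1 else 0 := Pi.single_apply _ _ _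

theorem isSymm_radialMatrix (f : ℕ → ℝ) : (radialMatrix Γ f).IsSymm :=
  IsSymm.ext fun y z => by rw [radialMatrix_apply, radialMatrix_apply, dist_comm]

variable [Fintype X]

theorem distMatrix_mul_apply (i : ℕ) (M : Matrix X X ℝ) (y z : X) :
    (distMatrix Γ i * M) y z = ∑ w ∈ sphere Γ y i, M w z := by
  simp only [mul_apply, distMatrix_apply, ite_mul, one_mul, zero_mul, ← sum_filter, sphere]

theorem distMatrix_mul_distMatrix_apply (hr : Γ.IsDistanceRegular) (i j : ℕ) (y z : X) :
    (distMatrix Γ i * distMatrix Γ j) y z = Γ.intersectionNumber (Γ.dist y z) i j := by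
  rw [← card_sphereInter hr]
  simp only [distMatrix_mul_apply, distMatrix_apply, dist_comm (v := z)]
  rw [sum_boole]
  congr 2
  ext w
  simp

theorem exists_radialMatrix_mul_eq (hr : Γ.IsDistanceRegular) (f g : ℕ → ℝ) :
    ∃ Φ, radialMatrix Γ f * radialMatrix Γ g = radialMatrix Γ Φ := by
  let I := range (Γ.diam + 1) ×ˢ range (Γ.diam + 1)
  refine ⟨fun h => ∑ p ∈ I, Γ.intersectionNumber h p.1 p.2 * (f p.1 * g p.2), ?_⟩
  ext x y
  have hmaps : ∀ s ∈ univ, (Γ.dist x s, Γ.dist y s) ∈ I := fun s _ => by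
    simp only [I, mem_product, mem_range]
    exact ⟨Nat.lt_succ_of_le (dist_le_diam hr x s), Nat.lt_succ_of_le (dist_le_diam hr y s)⟩
  simp only [mul_apply, radialMatrix_apply, dist_comm (v := y)]
  rw [← sum_fiberwise_of_maps_to hmaps]
  refine sum_congr rfl fun p _ => ?_
  have hfiber : ({s | (Γ.dist x s, Γ.dist y s) = p} : Finset X) = sphereInter Γ p.1 p.2 x y := by
    ext s
    simp [Prod.ext_iff]
  rw [hfiber, dist_comm (u := y), ← card_sphereInter hr, ← nsmul_eq_mul]
  refine sum_eq_card_nsmul fun s hs => ?_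
  obtain ⟨h₁, h₂⟩ := mem_sphereInter.1 hs
  rw [h₁, h₂]

theorem radialMatrix_mul_comm (hr : Γ.IsDistanceRegular) (f g : ℕ → ℝ) :
    radialMatrix Γ f * radialMatrix Γ g = radialMatrix Γ g * radialMatrix Γ f := by
  obtain ⟨Φ, hΦ⟩ := exists_radialMatrix_mul_eq hr f g
  calc radialMatrix Γ f * radialMatrix Γ g = (radialMatrix Γ f * radialMatrix Γ g)ᵀ := by
        rw [hΦ, (isSymm_radialMatrix Φ).eq]
    _ = radialMatrix Γ g * radialMatrix Γ f := by
        rw [transpose_mul, (isSymm_radialMatrix f).eq, (isSymm_radialMatrix g).eq]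

theorem distMatrix_one_mul_radialMatrix_apply (hr : Γ.IsDistanceRegular) (f : ℕ → ℝ) (y z : X) :
    (distMatrix Γ 1 * radialMatrix Γ f) y z =
      Γ.drgC (Γ.dist y z) * f (Γ.dist y z - 1) + Γ.drgA (Γ.dist y z) * f (Γ.dist y z) +
        Γ.drgB (Γ.dist y z) * f (Γ.dist y z + 1) := by
  simp only [distMatrix_mul_apply, radialMatrix_apply, dist_comm (v := z)]
  rw [dist_comm (u := z) (v := y)]
  simp only [sum_sphere_one hr, nsmul_eq_mul]

/-- `f` satisfies the three-term recurrence of an eigenvalue `θ` of `Γ`. At `i = 0` the truncated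
index `i - 1` is harmless, as `c_0 = 0`. -/
def IsCosineSequence (Γ : SimpleGraph X) (θ : ℝ) (f : ℕ → ℝ) : Prop :=
  ∀ i ≤ Γ.diam, Γ.drgC i * f (i - 1) + Γ.drgA i * f i + Γ.drgB i * f (i + 1) = θ * f i

theorem isCosineSequence_iff (hr : Γ.IsDistanceRegular) {θ : ℝ} {f : ℕ → ℝ} :
    IsCosineSequence Γ θ f ↔ distMatrix Γ 1 * radialMatrix Γ f = θ • radialMatrix Γ f := by
  refine ⟨fun hf => ?_, fun hf i hi => ?_⟩
  · ext y z
    rw [distMatrix_one_mul_radialMatrix_apply hr, hf _ (dist_le_diam hr y z)]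
    rfl
  · obtain ⟨x⟩ := hr.1.nonempty
    obtain ⟨y, rfl⟩ := exists_dist_eq hr x hi
    rw [← distMatrix_one_mul_radialMatrix_apply hr, hf]
    rfl

theorem IsCosineSequence.proportional (hr : Γ.IsDistanceRegular) {θ : ℝ} {f g : ℕ → ℝ}
    (hf : IsCosineSequence Γ θ f) (hg : IsCosineSequence Γ θ g) {i : ℕ} (hi : i ≤ Γ.diam) :
    g i * f 0 = g 0 * f i := by
  induction i using Nat.strong_induction_on with
  | _ i ih =>
    rcases i with _ | i
    · rfl
    · have hb : (Γ.drgB i : ℝ) ≠ 0 := Nat.cast_ne_zero.2 (drgB_pos hr hi).ne'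
      have ih₁ := ih i (by lia) (by lia)
      have ih₂ := ih (i - 1) (by lia) (by lia)
      have hfi := hf i (by lia)
      have hgi := hg i (by lia)
      apply mul_left_cancel₀ hb
      linear_combination f 0 * hgi - g 0 * hfi - Γ.drgC i * ih₂ - Γ.drgA i * ih₁ + θ * ih₁

theorem IsCosineSequence.exists_mul_self_eq_smul (hr : Γ.IsDistanceRegular) {θ : ℝ} {f : ℕ → ℝ}
    (hf : IsCosineSequence Γ θ f) (h0 : 0 < f 0) :
    ∃ c : ℝ, 0 < c ∧ radialMatrix Γ f * radialMatrix Γ f = c • radialMatrix Γ f := by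
  obtain ⟨Φ, hΦ⟩ := exists_radialMatrix_mul_eq hr f f
  have hΦcos : IsCosineSequence Γ θ Φ := by
    rw [isCosineSequence_iff hr, ← hΦ, ← Matrix.mul_assoc, (isCosineSequence_iff hr).1 hf,
      smul_mul_assoc]
  have hΦ0 : 0 < Φ 0 := by
    obtain ⟨x⟩ := hr.1.nonempty
    have hx : Φ 0 = ∑ s, f (Γ.dist x s) * f (Γ.dist x s) := by
      have hxx := congr_fun₂ hΦ x x
      simp only [mul_apply, radialMatrix_apply, dist_self, dist_comm (v := x)] at hxx
      exact hxx.symm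
    rw [hx]
    exact sum_pos' (fun s _ => mul_self_nonneg _) ⟨x, mem_univ x, by simpa using mul_pos h0 h0⟩
  refine ⟨Φ 0 / f 0, div_pos hΦ0 h0, ?_⟩
  rw [hΦ]
  ext y z
  rw [Matrix.smul_apply, smul_eq_mul, radialMatrix_apply, radialMatrix_apply, div_mul_eq_mul_div,
    eq_div_iff h0.ne', hf.proportional hr hΦcos (dist_le_diam hr y z)]

end RadialMatrices

section ClassicalParameters

variable {X : Type*} [Fintype X] {Γ : SimpleGraph X} {q α β : ℝ}

theorem gaussOne_zero (q : ℝ) : gaussOne q 0 = 0 := by simp [gaussOne]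

theorem gaussOne_one (q : ℝ) : gaussOne q 1 = 1 := by simp [gaussOne]

theorem gaussOne_two (q : ℝ) : gaussOne q 2 = 1 + q := by simp [gaussOne, sum_range_succ]

theorem gaussOne_three (q : ℝ) : gaussOne q 3 = 1 + q + q ^ 2 := by
  simp [gaussOne, sum_range_succ]

theorem gaussOne_mul_sub_one (q : ℝ) (i : ℕ) : gaussOne q i * (q - 1) = q ^ i - 1 :=
  geom_sum_mul q i

theorem cast_drgC (h : Γ.HasClassicalParameters Γ.diam q α β) {i : ℕ} (hi : i ≤ Γ.diam) :
    (Γ.drgC i : ℝ) = gaussOne q i * (1 + α * gaussOne q (i - 1)) := by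
  rcases i.eq_zero_or_pos with rfl | hpos
  · simp [drgC_zero h.1, gaussOne_zero]
  · exact h.2.2.1 i hpos hi

theorem cast_drgB (h : Γ.HasClassicalParameters Γ.diam q α β) {i : ℕ} (hi : i ≤ Γ.diam) :
    (Γ.drgB i : ℝ) = (gaussOne q Γ.diam - gaussOne q i) * (β - α * gaussOne q i) := by
  rcases hi.eq_or_lt with rfl | hlt
  · simp [drgB_diam h.1]
  · exact h.2.2.2 i hlt

theorem cast_drgA (hr : Γ.IsDistanceRegular) {i : ℕ} (hi : i ≤ Γ.diam) :
    (Γ.drgA i : ℝ) = Γ.drgB 0 - Γ.drgB i - Γ.drgC i := by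
  rw [← drgC_add_drgA_add_drgB hr hi]
  push_cast
  ring

theorem classical_recurrence (h : Γ.HasClassicalParameters Γ.diam q α β) (hq : q < -1)
    (hD : 1 ≤ Γ.diam) {i : ℕ} (hi : i ≤ Γ.diam) :
    Γ.drgC i * ((q ^ (i - 1))⁻¹ - (q ^ i)⁻¹) + Γ.drgB i * ((q ^ (i + 1))⁻¹ - (q ^ i)⁻¹) =
      (Γ.drgB 1 / q - 1 - Γ.drgB 0) * ((q ^ i)⁻¹ - 1) - (q - 1) / q * Γ.drgB 0 := by
  have hq0 : q ≠ 0 := by linarith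
  have hq1 : q - 1 ≠ 0 := by linarith
  have hgauss (j : ℕ) : gaussOne q j = (q ^ j - 1) / (q - 1) := by
    rw [eq_div_iff hq1, gaussOne_mul_sub_one]
  rcases i with _ | i
  · rw [drgC_zero h.1]
    simp only [CharP.cast_eq_zero, pow_zero, zero_add, pow_one]
    field_simp
    ring
  · simp only [cast_drgC h hi, cast_drgB h hi, cast_drgB h hD, cast_drgB h (Nat.zero_le _),
      Nat.add_sub_cancel, hgauss, pow_succ, pow_zero, one_mul]
    have ht : q ^ i ≠ 0 := pow_ne_zero _ hq0
    generalize q ^ i = t at *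
    field_simp
    ring

theorem exists_isCosineSequence (h : Γ.HasClassicalParameters Γ.diam q α β) (hq : q < -1)
    (hD : 2 ≤ Γ.diam) :
    ∃ η θ : ℝ, 0 < η + 1 ∧ IsCosineSequence Γ θ fun i => η + (q ^ i)⁻¹ := by
  have hb0 : (0 : ℝ) < Γ.drgB 0 := Nat.cast_pos.2 (drgB_pos h.1 (by lia))
  have hb1 : Γ.drgB 1 / q < 0 := div_neg_of_pos_of_neg (Nat.cast_pos.2 (drgB_pos h.1 hD))
    (by linarith)
  have hlt : 0 < Γ.drgB 0 - (Γ.drgB 1 / q - 1) := by linarith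
  have hquot : 0 < (q - 1) / q := div_pos_of_neg_of_neg (by linarith) (by linarith)
  refine ⟨(q - 1) / q * Γ.drgB 0 / (Γ.drgB 0 - (Γ.drgB 1 / q - 1)) - 1, Γ.drgB 1 / q - 1,
    by rw [sub_add_cancel]; positivity, fun i hi => ?_⟩
  have hη := div_mul_cancel₀ ((q - 1) / q * Γ.drgB 0) hlt.ne'
  generalize (q - 1) / q * Γ.drgB 0 / (Γ.drgB 0 - (Γ.drgB 1 / q - 1)) = w at *
  rw [cast_drgA h.1 hi]
  linear_combination classical_recurrence h hq (by lia) hi + hη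

theorem drgC_three_ne_two (h : Γ.HasClassicalParameters Γ.diam q α β) (hq : q < -1)
    (hD : 3 ≤ Γ.diam) : Γ.drgC 3 ≠ Γ.drgC 2 := by
  intro heq
  have hc2 : (0 : ℝ) < Γ.drgC 2 := Nat.cast_pos.2 (drgC_pos h.1 (by lia) (by lia))
  have hc3 : (Γ.drgC 3 : ℝ) = Γ.drgC 2 := by rw [heq]
  rw [cast_drgC h hD, cast_drgC h (by lia : 2 ≤ Γ.diam)] at hc3
  rw [cast_drgC h (by lia : 2 ≤ Γ.diam)] at hc2
  simp only [gaussOne_three, gaussOne_two, gaussOne_one, Nat.reduceSub, mul_one] at hc3 hc2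
  have hfactor : q * (q + α * (1 + q) ^ 2) = 0 := by linear_combination hc3
  have hα := (mul_eq_zero.1 hfactor).resolve_left (by linarith)
  nlinarith

theorem drgA_sub_drgA_one_mul_drgC (h : Γ.HasClassicalParameters Γ.diam q α β) {i : ℕ}
    (hi : i + 1 ≤ Γ.diam) :
    (Γ.drgA (i + 1) - Γ.drgA 1 * Γ.drgC (i + 1) : ℝ) =
      -α * gaussOne q (i + 1) * gaussOne q i * (q + 1 + Γ.drgA 1) := by
  have hsucc : gaussOne q (i + 1) = 1 + q * gaussOne q i := by
    rw [gaussOne, sum_range_succ', gaussOne, mul_sum, add_comm]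
    simp [pow_succ']
  rw [cast_drgA h.1 hi, cast_drgA h.1 (by lia : 1 ≤ Γ.diam), cast_drgB h (Nat.zero_le _),
    cast_drgB h hi, cast_drgB h (by lia : 1 ≤ Γ.diam), cast_drgC h hi,
    cast_drgC h (by lia : 1 ≤ Γ.diam)]
  simp only [Nat.add_sub_cancel, gaussOne_zero, gaussOne_one, Nat.sub_self, hsucc]
  ring

theorem drgA_eq_of_drgA_two_eq (h : Γ.HasClassicalParameters Γ.diam q α β) (hq : q < -1)
    (hD : 2 ≤ Γ.diam) (h2 : Γ.drgA 2 = Γ.drgA 1 * Γ.drgC 2) {i : ℕ} (hi : 1 ≤ i)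
    (hiD : i ≤ Γ.diam) : Γ.drgA i = Γ.drgA 1 * Γ.drgC i := by
  obtain ⟨j, rfl⟩ := Nat.exists_eq_add_of_le' hi
  have hidentity := drgA_sub_drgA_one_mul_drgC h hD
  rw [one_add_one_eq_two, h2, gaussOne_two, gaussOne_one] at hidentity
  push_cast at hidentity
  have hfactor : (1 + q) * (α * (q + 1 + Γ.drgA 1)) = 0 := by linear_combination hidentity
  have hα := (mul_eq_zero.1 hfactor).resolve_left (by linarith)
  have hcast : (Γ.drgA (j + 1) : ℝ) = Γ.drgA 1 * Γ.drgC (j + 1) := by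
    linear_combination drgA_sub_drgA_one_mul_drgC h hiD - gaussOne q (j + 1) * gaussOne q j * hα
  exact_mod_cast hcast

end ClassicalParameters

section QuadraticForm

variable {X : Type*} [Fintype X]

/-- The products `A y w * B w z` as a function of `w`: the walks of length two from `y` to `z`,
weighted by their middle vertex. -/
def middleVector (A B : Matrix X X ℝ) (y z : X) : X → ℝ := fun w => A y w * B w z

variable {A B F : Matrix X X ℝ} {f₀ f₁ f₂ : ℝ}

theorem mulVec_middleVector_left (hA : ∀ y z, F y z * A y z = f₁ * A y z) (y z : X) :
    (F *ᵥ middleVector A B y z) y = f₁ * (A * B) y z := by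
  simp only [mulVec, dotProduct, middleVector, mul_apply, mul_sum, ← mul_assoc, hA]

theorem mulVec_middleVector_right (hBs : B.IsSymm) (hB : ∀ y z, F y z * B y z = f₂ * B y z)
    (y z : X) : (F *ᵥ middleVector A B y z) z = f₂ * (A * B) y z := by
  simp only [mulVec, dotProduct, middleVector, mul_apply, mul_sum]
  refine sum_congr rfl fun w _ => ?_
  rw [hBs.apply z w]
  linear_combination A y w * hB z w

theorem sum_sum_middleVector_dotProduct {ι κ : Type*} [Fintype ι] [Fintype κ]
    (F : Matrix X X ℝ) (a b : ι → X → ℝ) (c d : κ → X → ℝ) :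
    ∑ y, ∑ z, (fun w => a y w * c z w) ⬝ᵥ F *ᵥ (fun w => b y w * d z w) =
      ∑ w, ∑ w', F w w' * ((∑ y, a y w * b y w') * ∑ z, c z w * d z w') := by
  calc _ = ∑ p : ι × κ, ∑ r : X × X,
        F r.1 r.2 * ((a p.1 r.1 * b p.1 r.2) * (c p.2 r.1 * d p.2 r.2)) := by
        simp only [Fintype.sum_prod_type, dotProduct, mulVec, mul_sum]
        exact sum_congr rfl fun y _ => sum_congr rfl fun z _ => sum_congr rfl fun w _ =>
          sum_congr rfl fun w' _ => by ring
    _ = _ := by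
        rw [sum_comm]
        simp only [Fintype.sum_prod_type, sum_mul_sum]
        simp only [mul_sum]

theorem sum_middleVector_self (hAs : A.IsSymm) (hBs : B.IsSymm) :
    ∑ y, ∑ z, middleVector A B y z ⬝ᵥ F *ᵥ middleVector A B y z =
      ∑ w, ∑ w', F w w' * ((A * A) w w' * (B * B) w w') := by
  have h := sum_sum_middleVector_dotProduct F A A Bᵀ Bᵀ
  simp only [transpose_apply] at h
  refine h.trans (sum_congr rfl fun w _ => sum_congr rfl fun w' _ => ?_)
  simp only [mul_apply, hAs.apply w, hBs.apply w']

theorem sum_middleVector_swap (hAs : A.IsSymm) (hBs : B.IsSymm) (hAB : A * B = B * A) :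
    ∑ y, ∑ z, middleVector A B y z ⬝ᵥ F *ᵥ middleVector A B z y =
      ∑ w, ∑ w', F w w' * (A * B) w w' ^ 2 := by
  have h := sum_sum_middleVector_dotProduct F A Bᵀ Bᵀ A
  simp only [transpose_apply] at h
  have hcomm (y z : X) : (fun w => Bᵀ y w * A z w) = middleVector A B z y :=
    funext fun w => mul_comm _ _
  simp only [transpose_apply] at hcomm
  simp only [hcomm] at h
  refine h.trans (sum_congr rfl fun w _ => sum_congr rfl fun w' _ => ?_)
  rw [sq]
  nth_rw 2 [hAB]
  simp only [mul_apply, hAs.apply w, hBs.apply w']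

theorem dotProduct_mulVec_comm (hF : F.IsSymm) (u v : X → ℝ) : u ⬝ᵥ F *ᵥ v = v ⬝ᵥ F *ᵥ u := by
  rw [dotProduct_mulVec, ← mulVec_transpose, hF.eq, dotProduct_comm]

variable [DecidableEq X]

/-- The vector `∑_{w ∈ Γ_A(y) ∩ Γ_B(z)} e_w - ∑_{w ∈ Γ_B(y) ∩ Γ_A(z)} e_w - r (e_y - e_z)` of
Terwilliger's balanced set condition, for `0`-`1` matrices `A` and `B`. -/
def balancedVector (A B : Matrix X X ℝ) (r : ℝ) (y z : X) : X → ℝ :=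
  middleVector A B y z - middleVector A B z y - r • (Pi.single y 1 - Pi.single z 1)

theorem balancedVector_dotProduct_mulVec (hBs : B.IsSymm) (hFs : F.IsSymm) (hABs : (A * B).IsSymm)
    (hF : ∀ y, F y y = f₀) (hA : ∀ y z, F y z * A y z = f₁ * A y z)
    (hB : ∀ y z, F y z * B y z = f₂ * B y z) (r : ℝ) (y z : X) :
    balancedVector A B r y z ⬝ᵥ F *ᵥ balancedVector A B r y z =
      middleVector A B y z ⬝ᵥ F *ᵥ middleVector A B y z +
        middleVector A B z y ⬝ᵥ F *ᵥ middleVector A B z y -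
        2 * (middleVector A B y z ⬝ᵥ F *ᵥ middleVector A B z y) +
        2 * ((f₀ - F y z) * r ^ 2) - 4 * ((f₁ - f₂) * ((A * B) y z * r)) := by
  have hyy := mulVec_middleVector_left (B := B) hA y z
  have hzz := mulVec_middleVector_left (B := B) hA z y
  have hyz := mulVec_middleVector_right (A := A) hBs hB y z
  have hzy := mulVec_middleVector_right (A := A) hBs hB z y
  rw [hABs.apply] at hzz hzy
  have hcol (u : X → ℝ) (w : X) : u ⬝ᵥ F.col w = (F *ᵥ u) w := by
    rw [← mulVec_single_one, dotProduct_mulVec_comm hFs, single_one_dotProduct]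
  simp only [balancedVector, mulVec_sub, mulVec_smul, dotProduct_sub, sub_dotProduct,
    smul_dotProduct, dotProduct_smul, smul_eq_mul, single_one_dotProduct,
    dotProduct_mulVec_comm hFs (middleVector A B z y) (middleVector A B y z),
    hcol, hyy, hzz, hyz, hzy, mulVec_single_one,
    Pi.sub_apply, Pi.smul_apply, col_apply, hF, hFs.apply y z]
  ring

theorem sum_balancedVector (hAs : A.IsSymm) (hBs : B.IsSymm) (hFs : F.IsSymm)
    (hAB : A * B = B * A) (hF : ∀ y, F y y = f₀) (hA : ∀ y z, F y z * A y z = f₁ * A y z)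
    (hB : ∀ y z, F y z * B y z = f₂ * B y z) (R : Matrix X X ℝ) :
    ∑ y, ∑ z, balancedVector A B (R y z) y z ⬝ᵥ F *ᵥ balancedVector A B (R y z) y z =
      2 * ∑ y, ∑ z, (F y z * ((A * A) y z * (B * B) y z - (A * B) y z ^ 2) +
        (f₀ - F y z) * R y z ^ 2 - 2 * ((f₁ - f₂) * ((A * B) y z * R y z))) := by
  have hABs : (A * B).IsSymm := by
    rw [IsSymm, transpose_mul, hAs.eq, hBs.eq, hAB]
  have hself := sum_middleVector_self (F := F) hAs hBs
  have hself' := hself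
  rw [sum_comm] at hself'
  have hswap := sum_middleVector_swap (F := F) hAs hBs hAB
  simp only [balancedVector_dotProduct_mulVec hBs hFs hABs hF hA hB, sum_sub_distrib,
    sum_add_distrib, ← mul_sum, hself, hself', hswap, mul_sub]
  ring

end QuadraticForm

section IntersectionMatrices

variable {X : Type*} [Fintype X] {Γ : SimpleGraph X}

theorem card_sphere_mul_drgB (hr : Γ.IsDistanceRegular) (x : X) (i : ℕ) :
    #(sphere Γ x i) * Γ.drgB i = #(sphere Γ x (i + 1)) * Γ.drgC (i + 1) := by
  refine card_mul_eq_card_mul (fun y z => Γ.dist y z = 1) (fun y hy => ?_) fun z hz => ?_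
  · rw [← card_sphereInter_succ hr rfl ((dist_comm ..).trans (mem_sphere.1 hy))]
    congr 1
    ext w
    rw [mem_bipartiteAbove, mem_sphere, mem_sphereInter, and_comm]
  · rw [← card_sphereInter_pred hr rfl ((dist_comm ..).trans (mem_sphere.1 hz))]
    congr 1
    ext w
    rw [mem_bipartiteBelow, mem_sphere, mem_sphereInter, and_comm, dist_comm]

theorem sum_dist (g : ℕ → ℝ) (x : X) {n : ℕ} (hg : ∀ y, n ≤ Γ.dist x y → g (Γ.dist x y) = 0) :
    ∑ y, g (Γ.dist x y) = ∑ i ∈ range n, #(sphere Γ x i) * g i := by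
  rw [← sum_filter_of_ne (p := fun y => Γ.dist x y < n)
    fun y _ hy => lt_of_not_ge fun hn => hy (hg y hn),
    ← sum_fiberwise_of_maps_to (t := range n) (g := Γ.dist x)
    fun y hy => mem_range.2 (mem_filter.1 hy).2]
  refine sum_congr rfl fun i hi => ?_
  have hfiber : ({y ∈ ({y | Γ.dist x y < n} : Finset X) | Γ.dist x y = i} : Finset X) =
      sphere Γ x i := by
    ext y
    simp only [mem_filter, mem_univ, true_and, mem_sphere, and_iff_right_iff_imp]
    exact fun h => h ▸ mem_range.1 hi
  rw [hfiber, ← nsmul_eq_mul]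
  exact sum_eq_card_nsmul fun y hy => by rw [mem_sphere.1 hy]

variable (hr : Γ.IsDistanceRegular)
include hr

theorem distMatrix_zero [DecidableEq X] : distMatrix Γ 0 = 1 := by
  ext y z
  simp only [distMatrix_apply, hr.1.dist_eq_zero_iff, one_apply]

theorem distMatrix_one_mul_distMatrix_succ (i : ℕ) :
    distMatrix Γ 1 * distMatrix Γ (i + 1) = (Γ.drgB i : ℝ) • distMatrix Γ i +
      (Γ.drgA (i + 1) : ℝ) • distMatrix Γ (i + 1) +
      (Γ.drgC (i + 2) : ℝ) • distMatrix Γ (i + 2) := by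
  ext y z
  refine (distMatrix_one_mul_radialMatrix_apply hr _ y z).trans ?_
  simp only [Matrix.add_apply, Matrix.smul_apply, smul_eq_mul, distMatrix_apply,
    Pi.single_apply]
  obtain hd | hd | hd | hd : Γ.dist y z = i ∨ Γ.dist y z = i + 1 ∨ Γ.dist y z = i + 2 ∨
      (Γ.dist y z ≠ i ∧ Γ.dist y z ≠ i + 1 ∧ Γ.dist y z ≠ i + 2) := by lia
  · simp [hd, show i - 1 ≠ i + 1 by lia]
  · simp [hd]
  · simp [hd]
  · simp [hd, show Γ.dist y z - 1 ≠ i + 1 by lia]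

theorem drgC_two_smul_distMatrix_two_mul_self :
    (Γ.drgC 2 : ℝ) • (distMatrix Γ 2 * distMatrix Γ 2) =
      (Γ.drgB 1 : ℝ) • (distMatrix Γ 1 * distMatrix Γ 1) +
      (Γ.drgA 2 - Γ.drgA 1 : ℝ) • (distMatrix Γ 1 * distMatrix Γ 2) +
      (Γ.drgC 3 : ℝ) • (distMatrix Γ 1 * distMatrix Γ 3) -
      (Γ.drgB 0 : ℝ) • distMatrix Γ 2 := by
  classical
  have h₁ := distMatrix_one_mul_distMatrix_succ hr 0
  have h₂ := distMatrix_one_mul_distMatrix_succ hr 1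
  rw [distMatrix_zero hr, zero_add, zero_add] at h₁
  have hA₂ : (Γ.drgC 2 : ℝ) • distMatrix Γ 2 = distMatrix Γ 1 * distMatrix Γ 1 -
      (Γ.drgB 0 : ℝ) • 1 - (Γ.drgA 1 : ℝ) • distMatrix Γ 1 := by
    rw [h₁]
    abel
  rw [← smul_mul_assoc, hA₂, sub_mul, sub_mul, Matrix.mul_assoc, smul_mul_assoc, smul_mul_assoc,
    Matrix.one_mul]
  nth_rw 1 [h₂]
  simp only [mul_add, mul_smul_comm, sub_smul]
  abel

theorem drgC_two_mul_intersectionNumber_two_two {i : ℕ} (hi : i ≤ Γ.diam) :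
    (Γ.drgC 2 * Γ.intersectionNumber i 2 2 : ℝ) = Γ.drgB 1 * Γ.intersectionNumber i 1 1 +
      (Γ.drgA 2 - Γ.drgA 1) * Γ.intersectionNumber i 1 2 +
      Γ.drgC 3 * Γ.intersectionNumber i 1 3 - if i = 2 then (Γ.drgB 0 : ℝ) else 0 := by
  obtain ⟨x⟩ := hr.1.nonempty
  obtain ⟨y, rfl⟩ := exists_dist_eq hr x hi
  have h := congr_fun₂ (drgC_two_smul_distMatrix_two_mul_self hr) x y
  simpa only [Matrix.add_apply, Matrix.sub_apply, Matrix.smul_apply, smul_eq_mul,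
    distMatrix_mul_distMatrix_apply hr, distMatrix_apply, mul_ite, mul_one, mul_zero] using h

theorem intersectionNumber_one_eq_zero {i j : ℕ} (hi : i ≤ Γ.diam) (hij : i + 1 < j ∨ j + 1 < i) :
    Γ.intersectionNumber i 1 j = 0 := by
  obtain ⟨x⟩ := hr.1.nonempty
  obtain ⟨y, rfl⟩ := exists_dist_eq hr x hi
  rw [← card_sphereInter hr, card_eq_zero, eq_empty_iff_forall_notMem]
  intro z hz
  obtain ⟨hxz, hyz⟩ := mem_sphereInter.1 hz
  have := dist_trichotomy hr.1 y hxz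
  rw [dist_comm] at hyz
  lia

end IntersectionMatrices

section Balanced

variable {X : Type*} [Fintype X] {Γ : SimpleGraph X} {q α β : ℝ}

/-- The coefficient of the balanced set condition for the distances `1` and `2` at a pair of
vertices at distance `i`, namely `p^i_{12} (f 1 - f 2) / (f 0 - f i)` for the cosine sequence
`f i = η + q⁻ⁱ`. -/
noncomputable def balancedCoeff (Γ : SimpleGraph X) (q : ℝ) : ℕ → ℝ
  | 1 => Γ.drgB 1 / q
  | 2 => Γ.drgA 2 / (1 + q)
  | 3 => Γ.drgC 3 * q / (1 + q + q ^ 2)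
  | _ => 0

theorem classical_balanced_identity (h : Γ.HasClassicalParameters Γ.diam q α β) (hq : q < -1)
    (hD : 3 ≤ Γ.diam) :
    (Γ.drgB 0 * (q + 1) + Γ.drgA 1 * Γ.drgA 2 : ℝ) =
      Γ.drgB 1 * Γ.drgC 2 * (1 + 1 / q) + Γ.drgA 2 ^ 2 / (1 + q) -
      Γ.drgB 2 * Γ.drgC 3 * (1 + q) / (q * (1 + q + q ^ 2)) := by
  have hq0 : q ≠ 0 := by linarith
  have hq1 : 1 + q ≠ 0 := by linarith
  have hq3 : 1 + q + q ^ 2 ≠ 0 := by nlinarith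
  rw [cast_drgA h.1 (i := 1) (by lia), cast_drgA h.1 (i := 2) (by lia)]
  simp only [cast_drgB h (i := 0) (by lia), cast_drgB h (i := 1) (by lia),
    cast_drgB h (i := 2) (by lia), cast_drgC h (i := 1) (by lia), cast_drgC h (i := 2) (by lia),
    cast_drgC h hD, gaussOne_zero, gaussOne_one, gaussOne_two, gaussOne_three, Nat.sub_self,
    show 2 - 1 = 1 from rfl, show 3 - 1 = 2 from rfl]
  generalize gaussOne q Γ.diam = G
  field_simp
  ring

/-- The contribution of a pair of vertices at distance `i` to the sum of squares in
`sum_balancedVector`, in terms of the intersection numbers `p^i_{11}`, `p^i_{12}`, `p^i_{22}`. -/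
noncomputable def balancedDefect (Γ : SimpleGraph X) (q : ℝ) (f : ℕ → ℝ) (i : ℕ) : ℝ :=
  f i * (Γ.intersectionNumber i 1 1 * Γ.intersectionNumber i 2 2 -
    Γ.intersectionNumber i 1 2 ^ 2) + (f 0 - f i) * balancedCoeff Γ q i ^ 2 -
    2 * ((f 1 - f 2) * (Γ.intersectionNumber i 1 2 * balancedCoeff Γ q i))

theorem drgC_two_mul_balancedDefect (hr : Γ.IsDistanceRegular) (f : ℕ → ℝ) {i : ℕ}
    (hi : i ≤ Γ.diam) :
    Γ.drgC 2 * balancedDefect Γ q f i =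
      f i * Γ.intersectionNumber i 1 1 * (Γ.drgB 1 * Γ.intersectionNumber i 1 1 +
        (Γ.drgA 2 - Γ.drgA 1) * Γ.intersectionNumber i 1 2 +
        Γ.drgC 3 * Γ.intersectionNumber i 1 3 - if i = 2 then (Γ.drgB 0 : ℝ) else 0) +
      Γ.drgC 2 * ((f 0 - f i) * balancedCoeff Γ q i ^ 2 -
        f i * Γ.intersectionNumber i 1 2 ^ 2 -
        2 * (f 1 - f 2) * Γ.intersectionNumber i 1 2 * balancedCoeff Γ q i) := by
  rw [balancedDefect]
  linear_combination f i * Γ.intersectionNumber i 1 1 *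
    drgC_two_mul_intersectionNumber_two_two hr hi

theorem balancedDefect_eq_zero (hr : Γ.IsDistanceRegular) (f : ℕ → ℝ) {i : ℕ} (hi : 4 ≤ i)
    (hiD : i ≤ Γ.diam) : balancedDefect Γ q f i = 0 := by
  obtain ⟨n, rfl⟩ := Nat.exists_eq_add_of_le' hi
  simp only [balancedDefect, balancedCoeff,
    intersectionNumber_one_eq_zero hr (j := 1) hiD (by lia),
    intersectionNumber_one_eq_zero hr (j := 2) hiD (by lia)]
  ring

/-- The vanishing of `∑ n_i Ψ_i`, with `Ψ_i` the balanced defects, after division by the common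
factor `b_0 b_1 / c_2`. -/
theorem classical_balanced_sum (h : Γ.HasClassicalParameters Γ.diam q α β) (hq : q < -1)
    (hD : 3 ≤ Γ.diam) {f : ℕ → ℝ} {η : ℝ} (hf : ∀ i, f i = η + (q ^ i)⁻¹) :
    f 0 * Γ.drgB 0 +
      (f 1 * Γ.drgA 1 * Γ.drgA 2 - Γ.drgC 2 * f 1 * Γ.drgB 1 +
        Γ.drgC 2 * (f 0 - f 1) * (Γ.drgB 1 / q ^ 2) -
        2 * Γ.drgC 2 * (f 1 - f 2) * (Γ.drgB 1 / q)) +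
      (f 2 * (Γ.drgB 1 * Γ.drgC 2 + Γ.drgC 3 * Γ.drgB 2 - Γ.drgA 1 * Γ.drgA 2 - Γ.drgB 0) +
        (f 0 - f 2) * (Γ.drgA 2 / (1 + q)) ^ 2 -
        2 * (f 1 - f 2) * Γ.drgA 2 * (Γ.drgA 2 / (1 + q))) +
      ((f 0 - f 3) * (q / (1 + q + q ^ 2)) ^ 2 - f 3 -
        2 * (f 1 - f 2) * (q / (1 + q + q ^ 2))) * Γ.drgC 3 * Γ.drgB 2 = 0 := by
  have hq0 : q ≠ 0 := by linarith
  have hq1 : 1 + q ≠ 0 := by linarith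
  have hq3 : 1 + q + q ^ 2 ≠ 0 := by nlinarith
  have key := sub_eq_zero.2 (classical_balanced_identity h hq hD)
  simp only [hf]
  linear_combination (norm := (field_simp; ring)) ((q - 1) / q ^ 2) * key

theorem sum_card_sphere_mul_balancedDefect (h : Γ.HasClassicalParameters Γ.diam q α β)
    (hq : q < -1) (hD : 3 ≤ Γ.diam) {f : ℕ → ℝ} {η : ℝ} (hf : ∀ i, f i = η + (q ^ i)⁻¹) (x : X) :
    ∑ i ∈ range 4, #(sphere Γ x i) * balancedDefect Γ q f i = 0 := by
  have hc2 : (Γ.drgC 2 : ℝ) ≠ 0 := Nat.cast_ne_zero.2 (drgC_pos h.1 (by lia) (by lia)).ne'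
  have h₀ := drgC_two_mul_balancedDefect (q := q) h.1 f (i := 0) (by lia)
  have h₁ := drgC_two_mul_balancedDefect (q := q) h.1 f (i := 1) (by lia)
  have h₂ := drgC_two_mul_balancedDefect (q := q) h.1 f (i := 2) (by lia)
  have h₃ := drgC_two_mul_balancedDefect (q := q) h.1 f (i := 3) (by lia)
  have hp : Γ.intersectionNumber 0 1 2 = 0 ∧ Γ.intersectionNumber 0 1 3 = 0 ∧
      Γ.intersectionNumber 1 1 3 = 0 ∧ Γ.intersectionNumber 3 1 1 = 0 := by
    refine ⟨?_, ?_, ?_, ?_⟩ <;> exact intersectionNumber_one_eq_zero h.1 (by lia) (by lia)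
  simp only [hp, balancedCoeff, show Γ.intersectionNumber 0 1 1 = Γ.drgB 0 from rfl,
    show Γ.intersectionNumber 1 1 1 = Γ.drgA 1 from rfl,
    show Γ.intersectionNumber 1 1 2 = Γ.drgB 1 from rfl,
    show Γ.intersectionNumber 2 1 1 = Γ.drgC 2 from rfl,
    show Γ.intersectionNumber 2 1 2 = Γ.drgA 2 from rfl,
    show Γ.intersectionNumber 2 1 3 = Γ.drgB 2 from rfl,
    show Γ.intersectionNumber 3 1 2 = Γ.drgC 3 from rfl, Nat.cast_zero,
    OfNat.zero_ne_ofNat, OfNat.one_ne_ofNat, Nat.reduceEqDiff, if_true, if_false] at h₀ h₁ h₂ h₃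
  have hn (i : ℕ) : (#(sphere Γ x i) * Γ.drgB i : ℝ) = #(sphere Γ x (i + 1)) * Γ.drgC (i + 1) :=
    mod_cast card_sphere_mul_drgB h.1 x i
  have hn₀ : #(sphere Γ x 0) = 1 := by
    rw [card_eq_one]
    exact ⟨x, by ext y; rw [mem_sphere, h.1.1.dist_eq_zero_iff, mem_singleton, eq_comm]⟩
  have hn₁ := card_sphere_one h.1 x
  have hn₂ := hn 1
  have hn₃ := hn 2
  simp only [sum_range_succ, sum_range_zero, zero_add, Nat.reduceAdd, hn₀, hn₁] at hn₂ hn₃ ⊢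
  apply mul_left_cancel₀ hc2
  linear_combination h₀ + Γ.drgB 0 * h₁ + #(sphere Γ x 2) * h₂ + #(sphere Γ x 3) * h₃ +
    Γ.drgC 2 * #(sphere Γ x 2) * classical_balanced_sum h hq hD hf +
    (f 0 * Γ.drgB 0 + (f 1 * Γ.drgA 1 * Γ.drgA 2 - Γ.drgC 2 * f 1 * Γ.drgB 1 +
      Γ.drgC 2 * (f 0 - f 1) * (Γ.drgB 1 / q ^ 2) -
      2 * Γ.drgC 2 * (f 1 - f 2) * (Γ.drgB 1 / q))) * hn₂ -
    Γ.drgC 2 * ((f 0 - f 3) * Γ.drgC 3 * (q / (1 + q + q ^ 2)) ^ 2 - f 3 * Γ.drgC 3 -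
      2 * (f 1 - f 2) * Γ.drgC 3 * (q / (1 + q + q ^ 2))) * hn₃

theorem sum_balancedVector_distMatrix [DecidableEq X] (hr : Γ.IsDistanceRegular) (f : ℕ → ℝ) :
    ∑ y, ∑ z, balancedVector (distMatrix Γ 1) (distMatrix Γ 2) (balancedCoeff Γ q (Γ.dist y z)) y z
        ⬝ᵥ radialMatrix Γ f *ᵥ balancedVector (distMatrix Γ 1) (distMatrix Γ 2)
          (balancedCoeff Γ q (Γ.dist y z)) y z =
      2 * ∑ y, ∑ z, balancedDefect Γ q f (Γ.dist y z) := by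
  have hentry (i : ℕ) (y z : X) :
      radialMatrix Γ f y z * distMatrix Γ i y z = f i * distMatrix Γ i y z := by
    rw [distMatrix_apply, radialMatrix_apply]
    split_ifs with hi <;> simp [hi]
  refine (sum_balancedVector (isSymm_radialMatrix _) (isSymm_radialMatrix _)
    (isSymm_radialMatrix f) (radialMatrix_mul_comm hr _ _)
    (fun y => by rw [radialMatrix_apply, dist_self]) (hentry 1) (hentry 2)
    (of fun y z => balancedCoeff Γ q (Γ.dist y z))).trans ?_
  simp only [← distMatrix.eq_def, distMatrix_mul_distMatrix_apply hr, of_apply, radialMatrix_apply,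
    balancedDefect]

theorem mulVec_balancedVector_eq_zero [DecidableEq X]
    (h : Γ.HasClassicalParameters Γ.diam q α β) (hq : q < -1) (hD : 3 ≤ Γ.diam) {f : ℕ → ℝ}
    {η θ : ℝ} (hf : ∀ i, f i = η + (q ^ i)⁻¹) (hf₀ : 0 < f 0) (hcos : IsCosineSequence Γ θ f)
    (y z : X) :
    radialMatrix Γ f *ᵥ balancedVector (distMatrix Γ 1) (distMatrix Γ 2)
      (balancedCoeff Γ q (Γ.dist y z)) y z = 0 := by
  obtain ⟨c, hc, hFF⟩ := hcos.exists_mul_self_eq_smul h.1 hf₀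
  have hsum := sum_balancedVector_distMatrix (q := q) h.1 f
  set F := radialMatrix Γ f
  set u : X → X → X → ℝ := fun y z => balancedVector (distMatrix Γ 1) (distMatrix Γ 2)
      (balancedCoeff Γ q (Γ.dist y z)) y z
  have hsq (y z : X) : (F *ᵥ u y z) ⬝ᵥ (F *ᵥ u y z) = c * (u y z ⬝ᵥ F *ᵥ u y z) := by
    rw [dotProduct_mulVec_comm (isSymm_radialMatrix f), mulVec_mulVec, hFF, smul_mulVec,
      dotProduct_smul, smul_eq_mul]
  have hnonneg (y z : X) : 0 ≤ u y z ⬝ᵥ F *ᵥ u y z :=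
    nonneg_of_mul_nonneg_right (hsq y z ▸ sum_nonneg fun _ _ => mul_self_nonneg _) hc
  have hdefect (y : X) : ∑ z, balancedDefect Γ q f (Γ.dist y z) = 0 := by
    rw [sum_dist _ y (n := 4), sum_card_sphere_mul_balancedDefect h hq hD hf]
    exact fun z hz => balancedDefect_eq_zero h.1 f hz (dist_le_diam h.1 y z)
  simp only [hdefect, sum_const_zero, mul_zero] at hsum
  have hzero : u y z ⬝ᵥ F *ᵥ u y z = 0 := by
    rw [sum_eq_zero_iff_of_nonneg fun y _ => sum_nonneg fun z _ => hnonneg y z] at hsum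
    exact (sum_eq_zero_iff_of_nonneg fun z _ => hnonneg y z).1 (hsum y (mem_univ y)) z (mem_univ z)
  exact dotProduct_self_eq_zero.1 ((hsq y z).trans (by rw [hzero, mul_zero]))

theorem radialMatrix_mulVec_middleVector (f : ℕ → ℝ) (i j : ℕ) (x y z : X) :
    (radialMatrix Γ f *ᵥ middleVector (distMatrix Γ i) (distMatrix Γ j) y z) x =
      ∑ w ∈ sphereInter Γ i j y z, f (Γ.dist x w) := by
  rw [sphereInter_comm]
  simp only [mulVec, dotProduct, middleVector, radialMatrix_apply, distMatrix_apply,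
    dist_comm (v := z), ← ite_and, mul_ite, mul_one, mul_zero, ← sum_filter, sphereInter]

theorem balanced (h : Γ.HasClassicalParameters Γ.diam q α β) (hq : q < -1) (hD : 3 ≤ Γ.diam)
    (x y z : X) :
    ∑ w ∈ sphereInter Γ 1 2 y z, (q ^ Γ.dist x w)⁻¹ -
        ∑ w ∈ sphereInter Γ 2 1 y z, (q ^ Γ.dist x w)⁻¹ =
      balancedCoeff Γ q (Γ.dist y z) * ((q ^ Γ.dist x y)⁻¹ - (q ^ Γ.dist x z)⁻¹) := by
  classical
  obtain ⟨η, θ, hη, hcos⟩ := exists_isCosineSequence h hq (by lia)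
  have hx := congr_fun
    (mulVec_balancedVector_eq_zero h hq hD (fun _ => rfl) (by simpa using hη) hcos y z) x
  have hcard : #(sphereInter Γ 1 2 z y) = #(sphereInter Γ 1 2 y z) := by
    rw [card_sphereInter h.1, card_sphereInter h.1, dist_comm]
  simp only [balancedVector, mulVec_sub, mulVec_smul, Pi.sub_apply, Pi.smul_apply,
    radialMatrix_mulVec_middleVector, smul_eq_mul, mulVec_single_one, col_apply,
    radialMatrix_apply, hcard, Pi.zero_apply, sum_add_distrib, sum_const] at hx
  rw [sphereInter_comm 2 1]
  linear_combination hx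

end Balanced

section Kites

variable {X : Type*} [Fintype X] {Γ : SimpleGraph X} {q α β : ℝ}

/-- `Γ` has no kites of length `n`: there are no adjacent vertices `y`, `w` that are both at
distance `1` from `x` and at distance `n - 1` from `z`, where `x` and `z` are at distance `n`. -/
def KiteFree (Γ : SimpleGraph X) (n : ℕ) : Prop :=
  ∀ ⦃x y z w : X⦄, Γ.dist x z = n → Γ.dist x y = 1 → Γ.dist z y + 1 = n → Γ.dist x w = 1 →
    Γ.dist z w + 1 = n → Γ.dist y w ≠ 1

/-- `Γ` has no parallelograms of length `n`: if `y` and `w` are neighbours of `x` and `z` at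
distance `n - 1` from `z` and `x`, where `x` and `z` are at distance `n`, then `y` and `w` are not
at distance `n - 1`. -/
def ParallelogramFree (Γ : SimpleGraph X) (n : ℕ) : Prop :=
  ∀ ⦃x y z w : X⦄, Γ.dist x z = n → Γ.dist x y = 1 → Γ.dist z y + 1 = n → Γ.dist z w = 1 →
    Γ.dist x w + 1 = n → Γ.dist y w + 1 ≠ n

theorem sum_comp_eq_of_le_add_two {ι : Type*} {s : Finset ι} {e : ι → ℕ} {m : ℕ}
    (h : ∀ i ∈ s, m ≤ e i ∧ e i ≤ m + 2) (g : ℕ → ℝ) :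
    ∑ i ∈ s, g (e i) = #{i ∈ s | e i = m} * g m + #{i ∈ s | e i = m + 1} * g (m + 1) +
      #{i ∈ s | e i = m + 2} * g (m + 2) := by
  simp only [sum_comp_eq_sum_Icc h g, sum_Icc_three, nsmul_eq_mul]

theorem card_eq_of_le_add_two {ι : Type*} {s : Finset ι} {e : ι → ℕ} {m : ℕ}
    (h : ∀ i ∈ s, m ≤ e i ∧ e i ≤ m + 2) :
    (#s : ℝ) = #{i ∈ s | e i = m} + #{i ∈ s | e i = m + 1} + #{i ∈ s | e i = m + 2} := by
  simpa using sum_comp_eq_of_le_add_two h fun _ => 1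

theorem filter_sphereInter_two_one_of_dist_eq_three (hc : Γ.Connected) {x y z : X}
    (hxz : Γ.dist x z = 3) (hxy : Γ.dist x y = 1) :
    {w ∈ sphereInter Γ 2 1 x z | Γ.dist y w = 1} = sphereInter Γ 1 1 y z := by
  ext w
  have := dist_trichotomy hc w hxy
  have := hc.dist_triangle (u := x) (v := w) (w := z)
  rw [dist_comm (u := w)] at this
  simp only [mem_filter, mem_sphereInter]
  lia

theorem kite_count (h : Γ.HasClassicalParameters Γ.diam q α β) (hq : q < -1) (hD : 3 ≤ Γ.diam)
    {x y z : X} (hxz : Γ.dist x z = 3) (hxy : Γ.dist x y = 1) (hzy : Γ.dist z y = 2) :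
    q * #{w ∈ sphereInter Γ 1 2 x z | Γ.dist y w = 1} =
      #{w ∈ sphereInter Γ 2 1 x z | Γ.dist y w = 2} := by
  have hc := h.1.1
  have hyx : Γ.dist y x = 1 := by rw [dist_comm, hxy]
  have hyz : Γ.dist y z = 2 := by rw [dist_comm, hzy]
  have hnear : ∀ w ∈ sphereInter Γ 1 2 x z, 0 ≤ Γ.dist y w ∧ Γ.dist y w ≤ 0 + 2 := fun w hw =>
    dist_mem_of_dist_eq_one hc hxy (mem_sphereInter.1 hw).1
  have hfar : ∀ w ∈ sphereInter Γ 2 1 x z, 1 ≤ Γ.dist y w ∧ Γ.dist y w ≤ 1 + 2 := fun w hw =>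
    dist_mem_of_dist_eq_one hc hxy (mem_sphereInter.1 hw).1
  have hself : #{w ∈ sphereInter Γ 1 2 x z | Γ.dist y w = 0} = 1 :=
    card_filter_dist_eq_zero hc (mem_sphereInter.2 ⟨hxy, hzy⟩)
  have hcommon : #{w ∈ sphereInter Γ 2 1 x z | Γ.dist y w = 1} = Γ.drgC 2 := by
    rw [filter_sphereInter_two_one_of_dist_eq_three hc hxz hxy, card_sphereInter_pred h.1 rfl hyz]
  have hcard := card_eq_of_le_add_two hnear
  have hcard' := card_eq_of_le_add_two hfar
  rw [card_sphereInter_pred h.1 rfl hxz] at hcard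
  rw [sphereInter_comm, card_sphereInter_pred h.1 rfl (by rw [dist_comm, hxz]),
    sphereInter_comm] at hcard'
  have hbal := balanced h hq hD y x z
  rw [hxz, hyx, hyz, sum_comp_eq_of_le_add_two hnear fun k => (q ^ k)⁻¹,
    sum_comp_eq_of_le_add_two hfar fun k => (q ^ k)⁻¹] at hbal
  rw [hself] at hcard hbal
  rw [hcommon] at hcard' hbal
  rw [cast_drgC h hD] at hcard hcard'
  rw [cast_drgC h (by lia : 2 ≤ Γ.diam)] at hcard' hbal
  simp only [balancedCoeff, cast_drgC h hD, gaussOne_one, gaussOne_two, gaussOne_three,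
    Nat.reduceSub, Nat.reduceAdd, zero_add] at hcard hcard' hbal
  generalize (#{w ∈ sphereInter Γ 1 2 x z | Γ.dist y w = 1} : ℝ) = K at *
  generalize (#{w ∈ sphereInter Γ 2 1 x z | Γ.dist y w = 2} : ℝ) = M at *
  have hq0 : q ≠ 0 := by linarith
  have hq3 : 1 + q + q ^ 2 ≠ 0 := by nlinarith
  have hfactor : (q - 1) * (q * K - M) = 0 := by
    linear_combination (norm := (field_simp; ring)) q ^ 3 * hbal + q * hcard - hcard'
  exact sub_eq_zero.1 ((mul_eq_zero.1 hfactor).resolve_left (by linarith))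

theorem kite_counts_eq_zero (h : Γ.HasClassicalParameters Γ.diam q α β) (hq : q < -1)
    (hD : 3 ≤ Γ.diam) {x y z : X} (hxz : Γ.dist x z = 3) (hxy : Γ.dist x y = 1)
    (hzy : Γ.dist z y = 2) :
    #{w ∈ sphereInter Γ 1 2 x z | Γ.dist y w = 1} = 0 ∧
      #{w ∈ sphereInter Γ 2 1 x z | Γ.dist y w = 2} = 0 := by
  have hcount := kite_count h hq hD hxz hxy hzy
  have hzero : (#{w ∈ sphereInter Γ 1 2 x z | Γ.dist y w = 1} : ℝ) = 0 := by
    nlinarith [Nat.cast_nonneg (α := ℝ) #{w ∈ sphereInter Γ 1 2 x z | Γ.dist y w = 1},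
      Nat.cast_nonneg (α := ℝ) #{w ∈ sphereInter Γ 2 1 x z | Γ.dist y w = 2}]
  rw [hzero, mul_zero] at hcount
  exact_mod_cast And.intro hzero hcount.symm

theorem kiteFree_three (h : Γ.HasClassicalParameters Γ.diam q α β) (hq : q < -1)
    (hD : 3 ≤ Γ.diam) : KiteFree Γ 3 := fun x y z w hxz hxy hzy hxw hzw hyw =>
  card_ne_zero_of_mem (mem_filter.2 ⟨mem_sphereInter.2 ⟨hxw, by lia⟩, hyw⟩)
    (kite_counts_eq_zero h hq hD hxz hxy (by lia)).1

theorem parallelogramFree_three (h : Γ.HasClassicalParameters Γ.diam q α β) (hq : q < -1)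
    (hD : 3 ≤ Γ.diam) : ParallelogramFree Γ 3 := fun x y z w hxz hxy hzy hzw hxw hyw =>
  card_ne_zero_of_mem (mem_filter.2 ⟨mem_sphereInter.2 ⟨by lia, hzw⟩, by lia⟩)
    (kite_counts_eq_zero h hq hD hxz hxy (by lia)).2

theorem KiteFree.of_succ (hr : Γ.IsDistanceRegular) {n : ℕ} (hk : KiteFree Γ (n + 1))
    (hn : n < Γ.diam) : KiteFree Γ n := by
  intro x y z w hxz hxy hzy hxw hzw
  obtain ⟨u, hzu, hxu⟩ := exists_dist_succ hr (hxz.trans_lt hn)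
  have hpred {v : X} (hxv : Γ.dist x v = 1) (hzv : Γ.dist z v + 1 = n) :
      Γ.dist u v + 1 = n + 1 := by
    have h₁ := dist_trichotomy hr.1 u hxv
    have h₂ := dist_trichotomy hr.1 v hzu
    rw [dist_comm (u := v)] at h₁
    lia
  exact hk (hxu.trans (by rw [hxz])) hxy (hpred hxy hzy) hxw (hpred hxw hzw)

theorem filter_sphereInter_one_two (hc : Γ.Connected) {x y z : X} (hxy : Γ.dist x y = 1)
    (hzy : Γ.dist z y = 2) (hno : ∀ v, Γ.dist x v = 1 → Γ.dist y v = 1 → Γ.dist z v ≠ 1) :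
    {w ∈ sphereInter Γ 1 2 z y | Γ.dist x w = 1} = sphereInter Γ 1 1 x z := by
  ext w
  have := dist_trichotomy hc w hxy
  have := dist_trichotomy hc y (x := z) (z := w)
  rw [dist_comm (u := w)] at this
  have := hno w
  simp only [mem_filter, mem_sphereInter]
  lia

theorem filter_sphereInter_two_one (hc : Γ.Connected) (hk : KiteFree Γ 3) {x y z : X}
    (hxy : Γ.dist x y = 1) (hzx : Γ.dist z x = 2) (hzy : Γ.dist z y = 2)
    (hno : ∀ v, Γ.dist x v = 1 → Γ.dist y v = 1 → Γ.dist z v ≠ 1) :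
    {w ∈ sphereInter Γ 2 1 z y | Γ.dist x w = 1} = sphereInter Γ 1 1 x y := by
  ext w
  have hkite := @hk w x z y
  rw [dist_comm (u := w), dist_comm (u := w), dist_comm (u := w)] at hkite
  have := dist_trichotomy hc z (x := x) (z := w)
  rw [dist_comm (u := x) (v := z), dist_comm (u := w)] at this
  have := hno w
  simp only [mem_filter, mem_sphereInter]
  lia

theorem card_filter_dist_eq_three (h : Γ.HasClassicalParameters Γ.diam q α β) (hq : q < -1)
    (hD : 3 ≤ Γ.diam) {x y z : X} (hxy : Γ.dist x y = 1) (hzx : Γ.dist z x = 2)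
    (hzy : Γ.dist z y = 2) (hno : ∀ v, Γ.dist x v = 1 → Γ.dist y v = 1 → Γ.dist z v ≠ 1) :
    #{w ∈ sphereInter Γ 1 2 z y | Γ.dist x w = 3} = 0 := by
  have hc := h.1.1
  have hxz : Γ.dist x z = 2 := by rw [dist_comm, hzx]
  have hyz : Γ.dist y z = 2 := by rw [dist_comm, hzy]
  have hyx : Γ.dist y x = 1 := by rw [dist_comm, hxy]
  have hfar : ∀ w ∈ sphereInter Γ 1 2 z y, 1 ≤ Γ.dist x w ∧ Γ.dist x w ≤ 1 + 2 := fun w hw =>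
    dist_mem_of_dist_eq_one hc hyx (mem_sphereInter.1 hw).2
  have hnear : ∀ w ∈ sphereInter Γ 2 1 z y, 0 ≤ Γ.dist x w ∧ Γ.dist x w ≤ 0 + 2 := fun w hw =>
    dist_mem_of_dist_eq_one hc hyx (mem_sphereInter.1 hw).2
  have hself : #{w ∈ sphereInter Γ 2 1 z y | Γ.dist x w = 0} = 1 :=
    card_filter_dist_eq_zero hc (mem_sphereInter.2 ⟨hzx, hyx⟩)
  have hcommon : #{w ∈ sphereInter Γ 1 2 z y | Γ.dist x w = 1} = Γ.drgC 2 := by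
    rw [filter_sphereInter_one_two hc hxy hzy hno, card_sphereInter_pred h.1 rfl hxz]
  have hcommon' : #{w ∈ sphereInter Γ 2 1 z y | Γ.dist x w = 1} = Γ.drgA 1 := by
    rw [filter_sphereInter_two_one hc (kiteFree_three h hq hD) hxy hzx hzy hno,
      card_sphereInter_self h.1 hxy]
  have hcard := card_eq_of_le_add_two hfar
  have hcard' := card_eq_of_le_add_two hnear
  rw [hcommon, card_sphereInter_self h.1 hzy] at hcard
  rw [hself, hcommon', sphereInter_comm, card_sphereInter_self h.1 hyz, sphereInter_comm] at hcard'
  have hbal := balanced h hq hD x z y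
  rw [hzy, hxz, hxy, sum_comp_eq_of_le_add_two hfar fun k => (q ^ k)⁻¹,
    sum_comp_eq_of_le_add_two hnear fun k => (q ^ k)⁻¹, hcommon, hself, hcommon'] at hbal
  simp only [balancedCoeff, cast_drgA h.1 (by lia : 1 ≤ Γ.diam),
    cast_drgA h.1 (by lia : 2 ≤ Γ.diam), cast_drgB h (Nat.zero_le _),
    cast_drgB h (by lia : 1 ≤ Γ.diam), cast_drgB h (by lia : 2 ≤ Γ.diam),
    cast_drgC h (by lia : 1 ≤ Γ.diam), cast_drgC h (by lia : 2 ≤ Γ.diam), gaussOne_zero,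
    gaussOne_one, gaussOne_two, Nat.reduceSub, Nat.reduceAdd, zero_add] at hcard hcard' hbal
  rw [← Nat.cast_eq_zero (R := ℝ)]
  generalize (#{w ∈ sphereInter Γ 1 2 z y | Γ.dist x w = 3} : ℝ) = Q at *
  have hq0 : q ≠ 0 := by linarith
  have hq1 : 1 + q ≠ 0 := by linarith
  have hfactor : (q - 1) * Q = 0 := by
    linear_combination (norm := (field_simp; ring)) -q ^ 3 * hbal - q * hcard + q * hcard'
  exact (mul_eq_zero.1 hfactor).resolve_left (by linarith)

end Kites

section LocalCliques

variable {X : Type*} [Fintype X] {Γ : SimpleGraph X} {x y z : X}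

/-- For a neighbour `y` of `x`, the clique of the local graph `Γ(x)` containing `y`: if `Γ` has no
kites of length two, then `Γ(x)` is a disjoint union of such cliques. -/
noncomputable def localClique (Γ : SimpleGraph X) (x y : X) : Finset X :=
  {t | Γ.dist x t = 1 ∧ Γ.dist y t ≤ 1}

@[simp]
theorem mem_localClique {t : X} : t ∈ localClique Γ x y ↔ Γ.dist x t = 1 ∧ Γ.dist y t ≤ 1 := by
  simp [localClique]

theorem mem_localClique_self (hy : Γ.dist x y = 1) : y ∈ localClique Γ x y := by simp [hy]

theorem localClique_subset : localClique Γ x y ⊆ sphere Γ x 1 := fun _ ht =>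
  mem_sphere.2 (mem_localClique.1 ht).1

theorem localClique_eq_of_mem (hc : Γ.Connected) (hk : KiteFree Γ 2) (hy : Γ.dist x y = 1) {t : X}
    (ht : t ∈ localClique Γ x y) : localClique Γ x t = localClique Γ x y := by
  obtain ⟨hxt, hyt⟩ := mem_localClique.1 ht
  ext s
  simp only [mem_localClique]
  refine and_congr_right fun hs => ?_
  have htri₁ := hc.dist_triangle (u := y) (v := t) (w := s)
  have htri₂ := hc.dist_triangle (u := t) (v := y) (w := s)
  rw [dist_comm (u := t) (v := y)] at htri₂
  have hk₁ := @hk y t s x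
  have hk₂ := @hk t y s x
  rw [dist_comm (u := s), dist_comm (u := s) (v := x), dist_comm (u := y) (v := x)] at hk₁
  rw [dist_comm (u := s), dist_comm (u := s) (v := x), dist_comm (u := t) (v := x),
    dist_comm (u := t) (v := y), dist_comm (u := y) (v := x)] at hk₂
  rw [dist_comm (u := t) (v := x)] at hk₁
  lia

theorem disjoint_localClique (hc : Γ.Connected) (hk : KiteFree Γ 2) (hy : Γ.dist x y = 1) {s : X}
    (hs : Γ.dist x s = 1) (hsy : s ∉ localClique Γ x y) :
    Disjoint (localClique Γ x y) (localClique Γ x s) := by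
  refine disjoint_left.2 fun t hty hts => hsy ?_
  rw [← localClique_eq_of_mem hc hk hy hty, localClique_eq_of_mem hc hk hs hts]
  exact mem_localClique_self hs

theorem card_localClique (hr : Γ.IsDistanceRegular) (hy : Γ.dist x y = 1) :
    #(localClique Γ x y) = Γ.drgA 1 + 1 := by
  classical
  rw [← card_sphereInter_self hr hy, ← card_insert_of_notMem (a := y) (by simp)]
  congr 1
  ext t
  simp only [mem_localClique, mem_insert, mem_sphereInter]
  rw [eq_comm (a := t), ← hr.1.dist_eq_zero_iff]
  have := hr.1.dist_triangle (u := x) (v := y) (w := t)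
  have := hr.1.dist_triangle (u := x) (v := t) (w := y)
  rw [dist_comm (u := t)] at this
  lia

theorem eq_of_mem_localClique_of_dist_eq_one (hc : Γ.Connected) (hk : KiteFree Γ 2)
    (hxz : Γ.dist x z = 2) {s t : X} (hs : Γ.dist x s = 1) (ht : t ∈ localClique Γ x s)
    (hzs : Γ.dist z s = 1) (hzt : Γ.dist z t = 1) : s = t := by
  obtain ⟨hxt, hst⟩ := mem_localClique.1 ht
  have := @hk x s z t hxz hs (by lia) hxt (by lia)
  exact hc.dist_eq_zero_iff.1 (by lia)

theorem dist_eq_three_of_mem_localClique (hc : Γ.Connected) (hk : KiteFree Γ 3)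
    (hzx : Γ.dist z x = 2) (hy : Γ.dist x y = 1) (hzy : Γ.dist z y = 3) {t : X}
    (ht : t ∈ localClique Γ x y) : Γ.dist z t = 3 := by
  obtain ⟨hxt, hyt⟩ := mem_localClique.1 ht
  have hkite := @hk y x z t
  have := hc.dist_triangle (u := z) (v := t) (w := y)
  have := hc.dist_triangle (u := z) (v := x) (w := t)
  rw [dist_comm (u := t)] at *
  rw [dist_comm (u := y), dist_comm (u := y)] at hkite
  lia

theorem filter_sphereInter_dist_eq_one (hc : Γ.Connected) (hk : KiteFree Γ 2)
    (hxz : Γ.dist x z = 2) {w : X} (hxw : Γ.dist x w = 1) (hzw : Γ.dist z w = 1) :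
    {y ∈ sphereInter Γ 1 2 x z | Γ.dist y w = 1} = sphereInter Γ 1 1 x w := by
  ext y
  have := @hk x w z y hxz hxw (by lia)
  have := dist_trichotomy hc z (x := w) (z := y)
  rw [dist_comm (u := w) (v := z), dist_comm (u := y) (v := z)] at this
  rw [mem_filter, mem_sphereInter, mem_sphereInter, dist_comm (u := y)]
  have := dist_trichotomy hc z (x := x) (z := y)
  rw [dist_comm (u := y) (v := z)] at this
  lia

theorem exists_localClique_dist_ne_one (hr : Γ.IsDistanceRegular) (hk : KiteFree Γ 2)
    (ha : Γ.drgA 2 ≠ Γ.drgA 1 * Γ.drgC 2) (hxz : Γ.dist x z = 2) :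
    ∃ y, Γ.dist x y = 1 ∧ Γ.dist z y = 2 ∧ ∀ t ∈ localClique Γ x y, Γ.dist z t ≠ 1 := by
  classical
  by_contra! hcon
  refine ha ?_
  have habove : ∀ y ∈ sphereInter Γ 1 2 x z,
      #((sphereInter Γ 1 1 x z).bipartiteAbove (Γ.dist · · = 1) y) = 1 := fun y hy => by
    obtain ⟨hxy, hzy⟩ := mem_sphereInter.1 hy
    obtain ⟨t, ht, hzt⟩ := hcon y hxy hzy
    obtain ⟨hxt, hyt⟩ := mem_localClique.1 ht
    have hyt0 : Γ.dist y t ≠ 0 := fun h0 => by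
      rw [← hr.1.dist_eq_zero_iff.1 h0] at hzt
      lia
    refine card_eq_one.2 ⟨t, eq_singleton_iff_unique_mem.2 ⟨?_, fun w hw => ?_⟩⟩
    · exact (mem_bipartiteAbove _).2 ⟨mem_sphereInter.2 ⟨hxt, hzt⟩, by lia⟩
    · obtain ⟨hw, hyw⟩ := (mem_bipartiteAbove _).1 hw
      obtain ⟨hxw, hzw⟩ := mem_sphereInter.1 hw
      refine (eq_of_mem_localClique_of_dist_eq_one hr.1 hk hxz hxt ?_ hzt hzw).symm
      rw [localClique_eq_of_mem hr.1 hk hxy ht]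
      exact mem_localClique.2 ⟨hxw, hyw.le⟩
  have hbelow : ∀ w ∈ sphereInter Γ 1 1 x z,
      #((sphereInter Γ 1 2 x z).bipartiteBelow (Γ.dist · · = 1) w) = Γ.drgA 1 := fun w hw => by
    obtain ⟨hxw, hzw⟩ := mem_sphereInter.1 hw
    rw [← card_sphereInter_self hr hxw, ← filter_sphereInter_dist_eq_one hr.1 hk hxz hxw hzw]
    rfl
  have hcount := card_mul_eq_card_mul _ habove hbelow
  rwa [card_sphereInter_self hr hxz, card_sphereInter_pred hr rfl hxz, mul_one, mul_comm] at hcount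

theorem exists_localClique_dist_eq_two (hr : Γ.IsDistanceRegular) (hk₂ : KiteFree Γ 2)
    (hk₃ : KiteFree Γ 3) (ha : Γ.drgA 2 ≠ Γ.drgA 1 * Γ.drgC 2) (hxz : Γ.dist x z = 2) :
    ∃ y, Γ.dist x y = 1 ∧ ∀ t ∈ localClique Γ x y, Γ.dist z t = 2 := by
  obtain ⟨y, hxy, hzy, hone⟩ := exists_localClique_dist_ne_one hr hk₂ ha hxz
  refine ⟨y, hxy, fun t ht => ?_⟩
  have hxt := (mem_localClique.1 ht).1
  have hzx : Γ.dist z x = 2 := by rw [dist_comm, hxz]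
  have hthree (hzt : Γ.dist z t = 3) : Γ.dist z y = 3 :=
    dist_eq_three_of_mem_localClique hr.1 hk₃ hzx hxt hzt <| by
      rw [localClique_eq_of_mem hr.1 hk₂ hxy ht]
      exact mem_localClique_self hxy
  have := dist_trichotomy hr.1 z hxt
  rw [dist_comm (u := t)] at this
  have := hone t ht
  lia

end LocalCliques

section Lowering

variable {X : Type*} {Γ : SimpleGraph X} {x : X}

/-- The lowering matrix with respect to `x`: the entry at `(y, z)` is `1` if `y` is a neighbour
of `z` that is closer to `x`. It agrees with `SimpleGraph.loweringMatrix` for the graph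
`Γ.flatDeleted x`, and its transpose is the raising matrix. -/
noncomputable def lowering (Γ : SimpleGraph X) (x : X) : Matrix X X ℂ :=
  of fun y z => if Γ.dist y z = 1 ∧ Γ.dist x z = Γ.dist x y + 1 then 1 else 0

/-- The characteristic vector of a set of vertices. -/
noncomputable def charVec (S : Finset X) : X → ℂ := (S : Set X).indicator 1

/-- The subspace `E*_i V` of the vectors supported on the sphere `Γ_i(x)`. -/
def subconstituent (Γ : SimpleGraph X) (x : X) (i : ℕ) : Submodule ℂ (X → ℂ) :=
  Submodule.pi {t | Γ.dist x t ≠ i} fun _ => ⊥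

theorem lowering_apply (y z : X) :
    lowering Γ x y z = if Γ.dist y z = 1 ∧ Γ.dist x z = Γ.dist x y + 1 then 1 else 0 := rfl

theorem lowering_eq_zero {y z : X} (h : Γ.dist x z ≠ Γ.dist x y + 1) : lowering Γ x y z = 0 :=
  if_neg fun h' => h h'.2

theorem conjTranspose_lowering : (lowering Γ x)ᴴ = (lowering Γ x)ᵀ := by
  ext y z
  simp [lowering_apply, apply_ite (starRingEnd ℂ), -dist_eq_one_iff_adj]

theorem mem_subconstituent {i : ℕ} {v : X → ℂ} :
    v ∈ subconstituent Γ x i ↔ ∀ t, Γ.dist x t ≠ i → v t = 0 := by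
  simp [subconstituent, Submodule.mem_pi]

theorem charVec_of_mem {S : Finset X} {s : X} (h : s ∈ S) : charVec S s = 1 := by
  simp [charVec, h]

theorem charVec_of_notMem {S : Finset X} {s : X} (h : s ∉ S) : charVec S s = 0 := by
  simp [charVec, h]

variable [Fintype X]

theorem mulVec_charVec (M : Matrix X X ℂ) (S : Finset X) (s : X) :
    (M *ᵥ charVec S) s = ∑ t ∈ S, M s t := by
  classical
  simp [mulVec, dotProduct, charVec, Set.indicator_apply, sum_ite_mem]

theorem charVec_mem_subconstituent {S : Finset X} {i : ℕ} (h : S ⊆ sphere Γ x i) :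
    charVec S ∈ subconstituent Γ x i :=
  mem_subconstituent.2 fun _ ht => charVec_of_notMem fun hS => ht (mem_sphere.1 (h hS))

theorem lowering_mulVec_mem {i : ℕ} {v : X → ℂ} (hv : v ∈ subconstituent Γ x (i + 1)) :
    lowering Γ x *ᵥ v ∈ subconstituent Γ x i := by
  rw [mem_subconstituent] at hv ⊢
  refine fun t ht => sum_eq_zero fun s _ => ?_
  beta_reduce
  by_cases hs : Γ.dist x s = i + 1
  · rw [lowering_eq_zero (by lia), zero_mul]
  · rw [hv s hs, mul_zero]

theorem transpose_lowering_mulVec_mem {i : ℕ} {v : X → ℂ} (hv : v ∈ subconstituent Γ x i) :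
    (lowering Γ x)ᵀ *ᵥ v ∈ subconstituent Γ x (i + 1) := by
  rw [mem_subconstituent] at hv ⊢
  refine fun t ht => sum_eq_zero fun s _ => ?_
  beta_reduce
  by_cases hs : Γ.dist x s = i
  · rw [transpose_apply, lowering_eq_zero (by lia), zero_mul]
  · rw [hv s hs, mul_zero]

theorem lowering_mul_lowering_apply (hr : Γ.IsDistanceRegular) {t w : X}
    (h : Γ.dist x w = Γ.dist x t + 2) :
    (lowering Γ x * lowering Γ x) t w = if Γ.dist t w = 2 then (Γ.drgC 2 : ℂ) else 0 := by
  have hpath (u : X) : lowering Γ x t u * lowering Γ x u w =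
      if Γ.dist t u = 1 ∧ Γ.dist w u = 1 then 1 else 0 := by
    have := hr.1.dist_triangle (u := x) (v := t) (w := u)
    have := hr.1.dist_triangle (u := x) (v := u) (w := w)
    rw [lowering_apply, lowering_apply, ite_zero_mul_ite_zero, one_mul, dist_comm (u := w)]
    exact if_congr (by lia) rfl rfl
  simp only [mul_apply, hpath, sum_boole]
  rw [← sphereInter]
  split_ifs with htw
  · rw [card_sphereInter_pred hr rfl htw]
  · rw [Nat.cast_eq_zero, card_eq_zero]
    refine eq_empty_of_forall_notMem fun u hu => htw ?_
    obtain ⟨htu, hwu⟩ := mem_sphereInter.1 hu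
    have := hr.1.dist_triangle (u := x) (v := t) (w := w)
    have := hr.1.dist_triangle (u := t) (v := u) (w := w)
    rw [dist_comm (u := u)] at this
    lia

theorem lowering_mul_transpose_apply {s t : X} {i : ℕ} (hs : Γ.dist x s = i)
    (ht : Γ.dist x t = i) :
    (lowering Γ x * (lowering Γ x)ᵀ) s t = #{u ∈ sphereInter Γ 1 1 s t | Γ.dist x u = i + 1} := by
  simp only [mul_apply, transpose_apply, lowering_apply, hs, ht, ite_zero_mul_ite_zero, one_mul,
    sum_boole]
  congr 2
  ext u
  simp only [mem_filter, mem_univ, true_and, mem_sphereInter]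
  tauto

theorem card_filter_common_neighbors (hr : Γ.IsDistanceRegular) (hk : KiteFree Γ 2) {s t : X}
    (hs : Γ.dist x s = 1) (ht : Γ.dist x t = 1) :
    (#{u ∈ sphereInter Γ 1 1 s t | Γ.dist x u = 2} : ℂ) =
      Γ.drgB 1 * (if Γ.dist s t = 0 then 1 else 0) +
        (Γ.drgC 2 - 1) * (if Γ.dist s t = 2 then 1 else 0) := by
  have hsx : Γ.dist s x = 1 := by rw [dist_comm, hs]
  have htx : Γ.dist t x = 1 := by rw [dist_comm, ht]
  have hst := hr.1.dist_triangle (u := s) (v := x) (w := t)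
  obtain h0 | h1 | h2 : Γ.dist s t = 0 ∨ Γ.dist s t = 1 ∨ Γ.dist s t = 2 := by lia
  · obtain rfl := hr.1.dist_eq_zero_iff.1 h0
    rw [← card_sphereInter_succ hr (j := 2) rfl hsx]
    have : {u ∈ sphereInter Γ 1 1 s s | Γ.dist x u = 2} = sphereInter Γ 1 2 s x := by
      ext u
      simp only [mem_filter, mem_sphereInter, and_self]
    simp [this]
  · have : {u ∈ sphereInter Γ 1 1 s t | Γ.dist x u = 2} = ∅ := by
      refine filter_false_of_mem fun u hu hxu => ?_
      obtain ⟨hsu, htu⟩ := mem_sphereInter.1 hu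
      rw [dist_comm] at hsu htu
      exact hk hxu hs (by lia) ht (by lia) h1
    simp [this, h1]
  · have hx : x ∈ sphereInter Γ 1 1 s t := mem_sphereInter.2 ⟨hsx, htx⟩
    have : {u ∈ sphereInter Γ 1 1 s t | Γ.dist x u ≠ 0} =
        {u ∈ sphereInter Γ 1 1 s t | Γ.dist x u = 2} := by
      refine filter_congr fun u hu => ?_
      obtain ⟨hsu, htu⟩ := mem_sphereInter.1 hu
      have := hk h2 hsx (by lia) hsu (by lia)
      have := hr.1.dist_triangle (u := x) (v := s) (w := u)
      lia
    have hcard := card_filter_add_card_filter_not (s := sphereInter Γ 1 1 s t) (Γ.dist x · = 0)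
    rw [card_filter_dist_eq_zero hr.1 hx, this, card_sphereInter_pred hr rfl h2] at hcard
    simp [h2, ← hcard]

theorem lowering_mul_transpose_mulVec_charVec (hr : Γ.IsDistanceRegular) (hk : KiteFree Γ 2)
    {S : Finset X} (hS : S ⊆ sphere Γ x 1) {s : X} (hs : Γ.dist x s = 1) :
    ((lowering Γ x * (lowering Γ x)ᵀ) *ᵥ charVec S) s =
      Γ.drgB 1 * charVec S s + (Γ.drgC 2 - 1) * #{t ∈ S | Γ.dist s t = 2} := by
  rw [mulVec_charVec]
  calc ∑ t ∈ S, (lowering Γ x * (lowering Γ x)ᵀ) s t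
      = ∑ t ∈ S, ((Γ.drgB 1 : ℂ) * (if Γ.dist s t = 0 then 1 else 0) +
          (Γ.drgC 2 - 1) * (if Γ.dist s t = 2 then 1 else 0)) := sum_congr rfl fun t ht => by
        have hxt := mem_sphere.1 (hS ht)
        rw [lowering_mul_transpose_apply hs hxt, card_filter_common_neighbors hr hk hs hxt]
    _ = Γ.drgB 1 * charVec S s + (Γ.drgC 2 - 1) * #{t ∈ S | Γ.dist s t = 2} := by
        rw [sum_add_distrib, ← mul_sum, ← mul_sum, sum_boole, sum_boole]
        by_cases hsS : s ∈ S
        · rw [card_filter_dist_eq_zero hr.1 hsS, charVec_of_mem hsS, Nat.cast_one]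
        · have : {t ∈ S | Γ.dist s t = 0} = ∅ := filter_false_of_mem fun t ht h0 =>
            hsS (hr.1.dist_eq_zero_iff.1 h0 ▸ ht)
          rw [this, charVec_of_notMem hsS, card_empty, Nat.cast_zero]

end Lowering

section CliqueVectors

variable {X : Type*} [Fintype X] {Γ : SimpleGraph X} {x : X}

theorem card_filter_localClique_dist_eq_two (hr : Γ.IsDistanceRegular) (hk : KiteFree Γ 2)
    {y s : X} (hy : Γ.dist x y = 1) (hs : Γ.dist x s = 1) :
    (#{t ∈ localClique Γ x y | Γ.dist s t = 2} : ℂ) =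
      (Γ.drgA 1 + 1) * (1 - charVec (localClique Γ x y) s) := by
  by_cases hsy : s ∈ localClique Γ x y
  · have : {t ∈ localClique Γ x y | Γ.dist s t = 2} = ∅ := filter_false_of_mem fun t ht => by
      rw [← localClique_eq_of_mem hr.1 hk hy hsy] at ht
      have := (mem_localClique.1 ht).2
      lia
    rw [this, charVec_of_mem hsy, card_empty, Nat.cast_zero, sub_self, mul_zero]
  · have : {t ∈ localClique Γ x y | Γ.dist s t = 2} = localClique Γ x y :=
      filter_true_of_mem fun t ht => by
        have hxt := (mem_localClique.1 ht).1
        have hts := disjoint_left.1 (disjoint_localClique hr.1 hk hy hs hsy) ht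
        rw [mem_localClique] at hts
        have := hr.1.dist_triangle (u := s) (v := x) (w := t)
        rw [dist_comm (u := s) (v := x)] at this
        lia
    rw [this, charVec_of_notMem hsy, card_localClique hr hy]
    push_cast
    ring

/-- The difference of the characteristic vectors of the cliques of `y₁` and `y₂` in `Γ(x)`: an
eigenvector of `L R` in the kernel of `L`. -/
noncomputable def cliqueDiff (Γ : SimpleGraph X) (x y₁ y₂ : X) : X → ℂ :=
  charVec (localClique Γ x y₁) - charVec (localClique Γ x y₂)

variable {y₁ y₂ : X}

theorem cliqueDiff_mem : cliqueDiff Γ x y₁ y₂ ∈ subconstituent Γ x 1 :=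
  sub_mem (charVec_mem_subconstituent localClique_subset)
    (charVec_mem_subconstituent localClique_subset)

theorem mulVec_cliqueDiff (M : Matrix X X ℂ) (s : X) :
    (M *ᵥ cliqueDiff Γ x y₁ y₂) s =
      ∑ t ∈ localClique Γ x y₁, M s t - ∑ t ∈ localClique Γ x y₂, M s t := by
  rw [cliqueDiff, mulVec_sub, Pi.sub_apply, mulVec_charVec, mulVec_charVec]

theorem lowering_mulVec_cliqueDiff (hr : Γ.IsDistanceRegular) (h₁ : Γ.dist x y₁ = 1)
    (h₂ : Γ.dist x y₂ = 1) : lowering Γ x *ᵥ cliqueDiff Γ x y₁ y₂ = 0 := by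
  have hmem := mem_subconstituent.1 (lowering_mulVec_mem (i := 0) (cliqueDiff_mem (Γ := Γ)
    (x := x) (y₁ := y₁) (y₂ := y₂)))
  ext s
  by_cases hs : Γ.dist x s = 0
  · obtain rfl := hr.1.dist_eq_zero_iff.1 hs
    have hsum {y : X} (hy : Γ.dist x y = 1) :
        ∑ t ∈ localClique Γ x y, lowering Γ x x t = (Γ.drgA 1 + 1 : ℕ) := by
      rw [← card_localClique hr hy, card_eq_sum_ones, Nat.cast_sum]
      refine sum_congr rfl fun t ht => ?_
      rw [lowering_apply, if_pos ⟨(mem_localClique.1 ht).1, by simp [(mem_localClique.1 ht).1]⟩,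
        Nat.cast_one]
    rw [mulVec_cliqueDiff, hsum h₁, hsum h₂, sub_self, Pi.zero_apply]
  · exact hmem s hs

theorem lowering_mul_transpose_mulVec_cliqueDiff (hr : Γ.IsDistanceRegular) (hk : KiteFree Γ 2)
    (h₁ : Γ.dist x y₁ = 1) (h₂ : Γ.dist x y₂ = 1) :
    (lowering Γ x * (lowering Γ x)ᵀ) *ᵥ cliqueDiff Γ x y₁ y₂ =
      (Γ.drgB 1 - (Γ.drgC 2 - 1) * (Γ.drgA 1 + 1) : ℂ) • cliqueDiff Γ x y₁ y₂ := by
  ext s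
  by_cases hs : Γ.dist x s = 1
  · rw [cliqueDiff, mulVec_sub, Pi.sub_apply,
      lowering_mul_transpose_mulVec_charVec hr hk localClique_subset hs,
      lowering_mul_transpose_mulVec_charVec hr hk localClique_subset hs,
      card_filter_localClique_dist_eq_two hr hk h₁ hs,
      card_filter_localClique_dist_eq_two hr hk h₂ hs, Pi.smul_apply, Pi.sub_apply, smul_eq_mul]
    ring
  · rw [← mulVec_mulVec, Pi.smul_apply, mem_subconstituent.1 cliqueDiff_mem s hs, smul_zero]
    exact mem_subconstituent.1 (lowering_mulVec_mem (transpose_lowering_mulVec_mem cliqueDiff_mem))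
      s hs

end CliqueVectors

section UniformRelations

variable {X : Type*} [Fintype X]

/-- The relation `e⁻ R L² + L R L + e⁺ L² R = f L` on the subspace `W`. -/
def UniformRelation (L R : Matrix X X ℂ) (W : Submodule ℂ (X → ℂ)) (em ep f : ℂ) : Prop :=
  ∀ w ∈ W, (em • (R * (L * L)) + L * R * L + ep • (L * L * R)) *ᵥ w = (f • L) *ᵥ w

theorem UniformRelation.apply {L R : Matrix X X ℂ} {W : Submodule ℂ (X → ℂ)} {em ep f : ℂ}
    (h : UniformRelation L R W em ep f) {w : X → ℂ} (hw : w ∈ W) :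
    em • R *ᵥ (L *ᵥ (L *ᵥ w)) + L *ᵥ (R *ᵥ (L *ᵥ w)) + ep • L *ᵥ (L *ᵥ (R *ᵥ w)) = f • L *ᵥ w := by
  simpa only [add_mulVec, smul_mulVec, mulVec_mulVec, mul_assoc] using h w hw

open scoped ComplexOrder in
theorem UniformRelation.exists_mulVec_eq_smul {L : Matrix X X ℂ} {W : Submodule ℂ (X → ℂ)}
    {em ep f θ : ℂ} (h : UniformRelation L Lᴴ W em ep f) (hep : ep ≠ 0) {v : X → ℂ}
    (hv : L *ᵥ (Lᴴ *ᵥ v) = θ • v) (hLv : L *ᵥ v = 0) (hW : Lᴴ *ᵥ v ∈ W)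
    (hW' : L *ᵥ (Lᴴ *ᵥ (Lᴴ *ᵥ v)) ∈ W) :
    ∃ κ : ℂ, L *ᵥ (Lᴴ *ᵥ (Lᴴ *ᵥ v)) = κ • Lᴴ *ᵥ v := by
  have hadj (a b : X → ℂ) : star a ⬝ᵥ (L *ᵥ b) = star (Lᴴ *ᵥ a) ⬝ᵥ b := by
    rw [star_mulVec, conjTranspose_conjTranspose, dotProduct_mulVec]
  have hadj' (a b : X → ℂ) : star a ⬝ᵥ (Lᴴ *ᵥ b) = star (L *ᵥ a) ⬝ᵥ b := by
    rw [star_mulVec, dotProduct_mulVec]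
  by_cases hθ : θ = 0
  · have hRv : Lᴴ *ᵥ v = 0 := by
      rw [← dotProduct_star_self_eq_zero, hadj', hv, hθ]
      simp
    exact ⟨0, by simp [hRv]⟩
  obtain ⟨μ, hμ⟩ : ∃ μ : ℂ, L *ᵥ (L *ᵥ (Lᴴ *ᵥ (Lᴴ *ᵥ v))) = μ • v := by
    have hRv := h.apply hW
    simp only [hv, mulVec_smul, hLv, mulVec_zero, smul_zero, zero_add, smul_smul] at hRv
    refine ⟨(f * θ - θ * θ) / ep, ?_⟩
    rw [div_eq_inv_mul, mul_smul, sub_smul, ← hRv, add_sub_cancel_left, inv_smul_smul₀ hep]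
  -- `u` is orthogonal to itself: `⟨u, R v⟩ = ⟨L u, v⟩ = 0` and `⟨u, L R² v⟩ = ⟨L² R u, v⟩ = 0`
  set u := L *ᵥ (Lᴴ *ᵥ (Lᴴ *ᵥ v)) - (μ / θ) • Lᴴ *ᵥ v with hu
  have hLu : L *ᵥ u = 0 := by
    rw [hu, mulVec_sub, mulVec_smul, hμ, hv, smul_smul, div_mul_cancel₀ _ hθ, sub_self]
  have hLLRu : L *ᵥ (L *ᵥ (Lᴴ *ᵥ u)) = 0 := by
    have hrel := h.apply (sub_mem hW' (W.smul_mem (μ / θ) hW))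
    rw [← hu, hLu] at hrel
    simpa [hep] using hrel
  have huu : star u ⬝ᵥ u = 0 := by
    conv_lhs => rw [hu, dotProduct_sub, ← hu]
    rw [dotProduct_smul, hadj' u, hLu, hadj, hadj', hadj', hLLRu]
    simp
  exact ⟨μ / θ, sub_eq_zero.1 (dotProduct_star_self_eq_zero.1 huu)⟩

end UniformRelations

section LevelTwo

variable {X : Type*} [Fintype X] {Γ : SimpleGraph X} {x z : X} {q α β : ℝ}

theorem lowering_mul_transpose_lowering_sq_apply (hr : Γ.IsDistanceRegular) {t : X}
    (h : Γ.dist x z = Γ.dist x t + 1) :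
    (lowering Γ x * (lowering Γ x * lowering Γ x)ᵀ) z t =
      Γ.drgC 2 * #{w ∈ sphereInter Γ 1 2 z t | Γ.dist x w = Γ.dist x z + 1} := by
  have hentry (w : X) : lowering Γ x z w * (lowering Γ x * lowering Γ x)ᵀ w t =
      Γ.drgC 2 *
        if (Γ.dist z w = 1 ∧ Γ.dist t w = 2) ∧ Γ.dist x w = Γ.dist x z + 1 then 1 else 0 := by
    rw [lowering_apply, transpose_apply]
    by_cases hw : Γ.dist x w = Γ.dist x z + 1
    · rw [lowering_mul_lowering_apply hr (by lia), ite_zero_mul_ite_zero]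
      simp only [hw, and_true, one_mul, mul_ite, mul_one, mul_zero]
    · simp [hw]
  simp only [mul_apply, hentry]
  rw [← mul_sum, sum_boole, ← filter_filter, ← sphereInter]

theorem transpose_lowering_mul_apply (hc : Γ.Connected) (M : Matrix X X ℂ) {s : X}
    (hs : Γ.dist x s = 1) : ((lowering Γ x)ᵀ * M) s z = M x z := by
  rw [mul_apply, Fintype.sum_eq_single x fun u hu => ?_, transpose_apply, lowering_apply, if_pos,
    one_mul]
  · simp [hs]
  · have := hc.pos_dist_of_ne hu.symm
    rw [transpose_apply, lowering_eq_zero (by lia), zero_mul]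

theorem lowering_mulVec_charVec_singleton (hxz : Γ.dist x z = 2) :
    lowering Γ x *ᵥ charVec {z} = charVec (sphereInter Γ 1 1 x z) := by
  ext s
  rw [mulVec_charVec, sum_singleton, lowering_apply, hxz, dist_comm]
  by_cases hs : s ∈ sphereInter Γ 1 1 x z
  · rw [charVec_of_mem hs, if_pos (by have := mem_sphereInter.1 hs; lia)]
  · rw [charVec_of_notMem hs, if_neg (by rw [mem_sphereInter] at hs; lia)]

theorem card_filter_dist_eq_three_add_drgC_two (hr : Γ.IsDistanceRegular)
    (hp : ParallelogramFree Γ 3) {t : X} (hxz : Γ.dist x z = 2) (hxt : Γ.dist x t = 1)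
    (hzt : Γ.dist z t = 3) :
    #{w ∈ sphereInter Γ 1 2 z t | Γ.dist x w = 3} + Γ.drgC 2 = Γ.drgC 3 := by
  have hzx : Γ.dist z x = 2 := by rw [dist_comm, hxz]
  have hnear : {w ∈ sphereInter Γ 1 2 z t | Γ.dist x w ≠ 3} = sphereInter Γ 1 1 x z := by
    ext w
    have := @hp t x z w (by rw [dist_comm, hzt]) (by rw [dist_comm, hxt]) (by lia)
    have := hr.1.dist_triangle (u := x) (v := z) (w := w)
    have := hr.1.dist_triangle (u := z) (v := w) (w := x)
    rw [dist_comm (u := w)] at this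
    have := hr.1.dist_triangle (u := z) (v := w) (w := t)
    rw [dist_comm (u := w)] at this
    have := hr.1.dist_triangle (u := t) (v := x) (w := w)
    rw [dist_comm (u := t) (v := x)] at this
    simp only [mem_filter, mem_sphereInter]
    lia
  rw [← card_sphereInter_pred hr rfl hzt, ← card_sphereInter_pred hr rfl hxz, ← hnear]
  exact card_filter_add_card_filter_not _

theorem UniformRelation.left_coeff_mul_drgC_two (hr : Γ.IsDistanceRegular) (hk : KiteFree Γ 2)
    {em f : ℂ} (hrel : UniformRelation (lowering Γ x) (lowering Γ x)ᵀ (subconstituent Γ x 2) em 0 f)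
    {s : X} (hxz : Γ.dist x z = 2) (hxs : Γ.dist x s = 1) (hzs : Γ.dist z s ≠ 1) :
    em * Γ.drgC 2 + (Γ.drgC 2 - 1) * #{t ∈ sphereInter Γ 1 1 x z | Γ.dist s t = 2} = 0 := by
  have hsub : sphereInter Γ 1 1 x z ⊆ sphere Γ x 1 := fun t ht =>
    mem_sphere.2 (mem_sphereInter.1 ht).1
  have hs : s ∉ sphereInter Γ 1 1 x z := fun hs => hzs (mem_sphereInter.1 hs).2
  have hRLL : ((lowering Γ x)ᵀ *ᵥ (lowering Γ x *ᵥ (lowering Γ x *ᵥ charVec {z}))) s =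
      Γ.drgC 2 := by
    rw [mulVec_mulVec, mulVec_mulVec, mulVec_charVec, sum_singleton, mul_assoc,
      transpose_lowering_mul_apply hr.1 _ hxs, lowering_mul_lowering_apply hr (by simp [hxz]),
      if_pos hxz]
  have hLRL : (lowering Γ x *ᵥ ((lowering Γ x)ᵀ *ᵥ (lowering Γ x *ᵥ charVec {z}))) s =
      (Γ.drgC 2 - 1) * #{t ∈ sphereInter Γ 1 1 x z | Γ.dist s t = 2} := by
    rw [lowering_mulVec_charVec_singleton hxz, mulVec_mulVec,
      lowering_mul_transpose_mulVec_charVec hr hk hsub hxs, charVec_of_notMem hs, mul_zero,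
      zero_add]
  have hL : (lowering Γ x *ᵥ charVec {z}) s = 0 := by
    rw [lowering_mulVec_charVec_singleton hxz, charVec_of_notMem hs]
  have hmem : charVec {z} ∈ subconstituent Γ x 2 :=
    charVec_mem_subconstituent (singleton_subset_iff.2 (mem_sphere.2 hxz))
  have happly := congrFun (hrel.apply hmem) s
  simpa only [Pi.add_apply, Pi.smul_apply, smul_eq_mul, hRLL, hLRL, hL, zero_mul, mul_zero,
    add_zero] using happly

theorem card_filter_common_neighbors_add_one (hc : Γ.Connected) (hk : KiteFree Γ 2) {w s : X}
    (hxz : Γ.dist x z = 2) (hw : w ∈ sphereInter Γ 1 1 x z) (hxs : Γ.dist x s = 1)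
    (hws : Γ.dist w s = 1) :
    #{t ∈ sphereInter Γ 1 1 x z | Γ.dist s t = 2} + 1 = #(sphereInter Γ 1 1 x z) := by
  obtain ⟨hxw, hzw⟩ := mem_sphereInter.1 hw
  have hnot : {t ∈ sphereInter Γ 1 1 x z | Γ.dist s t ≠ 2} = {w} := by
    refine eq_singleton_iff_unique_mem.2 ⟨?_, fun t ht => ?_⟩
    · rw [mem_filter, dist_comm (u := s), hws]
      exact ⟨hw, by decide⟩
    · rw [mem_filter, mem_sphereInter] at ht
      obtain ⟨⟨hxt, hzt⟩, hst⟩ := ht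
      have htri := hc.dist_triangle (u := s) (v := x) (w := t)
      rw [dist_comm (u := s) (v := x)] at htri
      have ht : t ∈ localClique Γ x s := mem_localClique.2 ⟨hxt, by lia⟩
      rw [localClique_eq_of_mem hc hk hxw (mem_localClique.2 ⟨hxs, hws.le⟩)] at ht
      exact (eq_of_mem_localClique_of_dist_eq_one hc hk hxz hxw ht hzw hzt).symm
  rw [← card_filter_add_card_filter_not (s := sphereInter Γ 1 1 x z) (Γ.dist s · = 2), hnot,
    card_singleton]

theorem UniformRelation.left_coeff_eq_zero (hr : Γ.IsDistanceRegular) (hD : 3 ≤ Γ.diam)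
    (hk : KiteFree Γ 2) (ha : Γ.drgA 1 ≠ 0) {em f : ℂ}
    (hrel : UniformRelation (lowering Γ x) (lowering Γ x)ᵀ (subconstituent Γ x 2) em 0 f) :
    em = 0 := by
  obtain ⟨z, hxz⟩ := exists_dist_eq hr x (i := 2) (by lia)
  have hzx : Γ.dist z x = 2 := by rw [dist_comm, hxz]
  have hcommon := card_sphereInter_pred hr rfl hxz
  have hc₂ := drgC_pos hr one_le_two (by lia : 2 ≤ Γ.diam)
  have hfar : em * Γ.drgC 2 + (Γ.drgC 2 - 1) * Γ.drgC 2 = 0 := by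
    obtain ⟨s, hxs, hzs⟩ := exists_dist_succ hr (x := z) (y := x) (by lia)
    have hall : {t ∈ sphereInter Γ 1 1 x z | Γ.dist s t = 2} = sphereInter Γ 1 1 x z :=
      filter_true_of_mem fun t ht => by
        obtain ⟨hxt, hzt⟩ := mem_sphereInter.1 ht
        have := hr.1.dist_triangle (u := z) (v := t) (w := s)
        have := dist_trichotomy hr.1 t hxs
        rw [dist_comm (u := s)] at *
        lia
    simpa only [hall, hcommon] using hrel.left_coeff_mul_drgC_two hr hk hxz hxs (by lia)
  have hnear : em * Γ.drgC 2 + (Γ.drgC 2 - 1) * (Γ.drgC 2 - 1) = 0 := by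
    obtain ⟨w, hw⟩ := card_pos.1 (hc₂.trans_eq hcommon.symm)
    obtain ⟨hxw, hzw⟩ := mem_sphereInter.1 hw
    rw [← Nat.pos_iff_ne_zero, ← card_sphereInter_self hr hxw] at ha
    obtain ⟨s, hs⟩ := card_pos.1 ha
    obtain ⟨hxs, hws⟩ := mem_sphereInter.1 hs
    have hcard := card_filter_common_neighbors_add_one hr.1 hk hxz hw hxs hws
    rw [hcommon] at hcard
    have hzs : Γ.dist z s ≠ 1 := fun hzs => hk hxz hxw (by lia) hxs (by lia) hws
    simpa only [← hcard, Nat.cast_add, Nat.cast_one, add_sub_cancel_right] using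
      hrel.left_coeff_mul_drgC_two hr hk hxz hxs hzs
  have hc₂' : (Γ.drgC 2 : ℂ) ≠ 0 := Nat.cast_ne_zero.2 hc₂.ne'
  refine (mul_eq_zero.1 ?_).resolve_right hc₂'
  linear_combination (1 - (Γ.drgC 2 : ℂ)) * hfar + Γ.drgC 2 * hnear

theorem sum_localClique_lowering_mul_eq_zero (h : Γ.HasClassicalParameters Γ.diam q α β)
    (hq : q < -1) (hD : 3 ≤ Γ.diam) (hk : KiteFree Γ 2) {y : X} (hxz : Γ.dist x z = 2)
    (hxy : Γ.dist x y = 1) (hy : ∀ t ∈ localClique Γ x y, Γ.dist z t = 2) :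
    ∑ t ∈ localClique Γ x y, (lowering Γ x * (lowering Γ x * lowering Γ x)ᵀ) z t = 0 := by
  refine sum_eq_zero fun t ht => ?_
  have hxt := (mem_localClique.1 ht).1
  have hzx : Γ.dist z x = 2 := by rw [dist_comm, hxz]
  have hno : ∀ v, Γ.dist x v = 1 → Γ.dist t v = 1 → Γ.dist z v ≠ 1 := fun v hxv htv hzv => by
    have hv : v ∈ localClique Γ x t := mem_localClique.2 ⟨hxv, htv.le⟩
    rw [localClique_eq_of_mem h.1.1 hk hxy ht] at hv
    have := hy v hv
    lia
  have hcard := card_filter_dist_eq_three h hq hD hxt hzx (hy t ht) hno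
  rw [lowering_mul_transpose_lowering_sq_apply h.1 (by lia), hxz, hcard, Nat.cast_zero, mul_zero]

theorem sum_localClique_lowering_mul (hr : Γ.IsDistanceRegular) (hk : KiteFree Γ 3)
    (hp : ParallelogramFree Γ 3) {y : X} (hxz : Γ.dist x z = 2) (hxy : Γ.dist x y = 1)
    (hzy : Γ.dist z y = 3) :
    ∑ t ∈ localClique Γ x y, (lowering Γ x * (lowering Γ x * lowering Γ x)ᵀ) z t =
      (Γ.drgA 1 + 1) * (Γ.drgC 2 * (Γ.drgC 3 - Γ.drgC 2)) := by
  have hentry : ∀ t ∈ localClique Γ x y, (lowering Γ x * (lowering Γ x * lowering Γ x)ᵀ) z t =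
      Γ.drgC 2 * (Γ.drgC 3 - Γ.drgC 2) := fun t ht => by
    have hxt := (mem_localClique.1 ht).1
    have hzt := dist_eq_three_of_mem_localClique hr.1 hk (by rw [dist_comm, hxz]) hxy hzy ht
    rw [lowering_mul_transpose_lowering_sq_apply hr (by lia), hxz,
      ← card_filter_dist_eq_three_add_drgC_two hr hp hxz hxt hzt, Nat.cast_add,
      add_sub_cancel_right]
  rw [sum_congr rfl hentry, sum_const, card_localClique hr hxy, nsmul_eq_mul, Nat.cast_add,
    Nat.cast_one]

theorem UniformRelation.exists_mulVec_cliqueDiff_eq_smul (hr : Γ.IsDistanceRegular)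
    (hk : KiteFree Γ 2) {y₁ y₂ : X} {em ep f : ℂ} (h₁ : Γ.dist x y₁ = 1) (h₂ : Γ.dist x y₂ = 1)
    (hrel : UniformRelation (lowering Γ x) (lowering Γ x)ᵀ (subconstituent Γ x 2) em ep f)
    (hep : ep ≠ 0) :
    ∃ κ : ℂ, (lowering Γ x * (lowering Γ x * lowering Γ x)ᵀ) *ᵥ cliqueDiff Γ x y₁ y₂ =
      κ • (lowering Γ x)ᵀ *ᵥ cliqueDiff Γ x y₁ y₂ := by
  have hRv :=
    transpose_lowering_mulVec_mem (cliqueDiff_mem (Γ := Γ) (x := x) (y₁ := y₁) (y₂ := y₂))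
  have hLRRv := lowering_mulVec_mem (transpose_lowering_mulVec_mem hRv)
  have hLR := lowering_mul_transpose_mulVec_cliqueDiff hr hk h₁ h₂
  rw [← mulVec_mulVec] at hLR
  rw [← conjTranspose_lowering] at hrel hRv hLRRv hLR
  obtain ⟨κ, hκ⟩ :=
    hrel.exists_mulVec_eq_smul hep hLR (lowering_mulVec_cliqueDiff hr h₁ h₂) hRv hLRRv
  refine ⟨κ, ?_⟩
  rwa [conjTranspose_lowering, mulVec_mulVec, mulVec_mulVec, mul_assoc, ← transpose_mul] at hκ

theorem UniformRelation.right_coeff_eq_zero (h : Γ.HasClassicalParameters Γ.diam q α β)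
    (hq : q < -1) (hD : 3 ≤ Γ.diam) (ha : Γ.drgA 2 ≠ Γ.drgA 1 * Γ.drgC 2) {em ep f : ℂ}
    (hrel : UniformRelation (lowering Γ x) (lowering Γ x)ᵀ (subconstituent Γ x 2) em ep f) :
    ep = 0 := by
  have hr := h.1
  have hk₃ := kiteFree_three h hq hD
  have hk₂ := hk₃.of_succ hr (by lia)
  obtain ⟨z, hxz⟩ := exists_dist_eq hr x (i := 2) (by lia)
  have hzx : Γ.dist z x = 2 := by rw [dist_comm, hxz]
  obtain ⟨y₁, hxy₁, hy₁⟩ := exists_localClique_dist_eq_two hr hk₂ hk₃ ha hxz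
  obtain ⟨y₂, hxy₂, hzy₂⟩ := exists_dist_succ hr (x := z) (y := x) (by lia)
  rw [hzx] at hzy₂
  have hR : ((lowering Γ x)ᵀ *ᵥ cliqueDiff Γ x y₁ y₂) z = 0 := by
    have hsum {y : X} (hy : ∀ t ∈ localClique Γ x y, Γ.dist z t ≠ 1) :
        ∑ t ∈ localClique Γ x y, (lowering Γ x)ᵀ z t = 0 := sum_eq_zero fun t ht =>
      if_neg fun htz => hy t ht (by rw [dist_comm, htz.1])
    rw [mulVec_cliqueDiff, hsum fun t ht => by rw [hy₁ t ht]; decide, hsum fun t ht => by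
      rw [dist_eq_three_of_mem_localClique hr.1 hk₃ hzx hxy₂ hzy₂ ht]; decide, sub_self]
  by_contra hep
  obtain ⟨κ, hκ⟩ := hrel.exists_mulVec_cliqueDiff_eq_smul hr hk₂ hxy₁ hxy₂ hep
  have hz := congrFun hκ z
  rw [Pi.smul_apply, hR, smul_zero, mulVec_cliqueDiff,
    sum_localClique_lowering_mul_eq_zero h hq hD hk₂ hxz hxy₁ hy₁,
    sum_localClique_lowering_mul hr hk₃ (parallelogramFree_three h hq hD) hxz hxy₂ hzy₂, zero_sub,
    neg_eq_zero, mul_eq_zero, mul_eq_zero] at hz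
  have hc₂ := drgC_pos hr one_le_two (by lia : 2 ≤ Γ.diam)
  obtain ha₁ | hc₂' | hc₃ := hz
  · exact Nat.cast_add_one_ne_zero _ ha₁
  · exact hc₂.ne' (Nat.cast_eq_zero.1 hc₂')
  · exact drgC_three_ne_two h hq hD (Nat.cast_injective (sub_eq_zero.1 hc₃))

end LevelTwo

section FlatDeleted

variable {X : Type*} {Γ : SimpleGraph X} {x : X}

theorem exists_flatDeleted_walk (hc : Γ.Connected) :
    ∀ {n : ℕ} {y : X}, Γ.dist x y = n → ∃ p : (Γ.flatDeleted x).Walk x y, p.length = n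
  | 0, y, hy => by
    obtain rfl := hc.dist_eq_zero_iff.1 hy
    exact ⟨Walk.nil, rfl⟩
  | n + 1, y, hy => by
    obtain ⟨z, hz, hzy⟩ := exists_dist_eq_of_le_dist hc (x := x) (y := y) (i := n) (by lia)
    obtain ⟨p, hp⟩ := exists_flatDeleted_walk hc hz
    have hadj : (Γ.flatDeleted x).Adj z y := ⟨dist_eq_one_iff_adj.1 (by lia), by lia⟩
    exact ⟨p.concat hadj, by rw [Walk.length_concat, hp]⟩

theorem flatDeleted_connected (hc : Γ.Connected) : (Γ.flatDeleted x).Connected :=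
  (connected_iff_exists_forall_reachable _).2
    ⟨x, fun _ => (exists_flatDeleted_walk hc rfl).choose.reachable⟩

theorem flatDeleted_dist (hc : Γ.Connected) (y : X) :
    (Γ.flatDeleted x).dist x y = Γ.dist x y := by
  refine le_antisymm ?_ ((flatDeleted_connected hc x y).dist_anti fun _ _ hadj => hadj.1)
  obtain ⟨p, hp⟩ := exists_flatDeleted_walk hc (x := x) (y := y) rfl
  exact hp ▸ dist_le p

theorem lowering_flatDeleted (hc : Γ.Connected) :
    lowering (Γ.flatDeleted x) x = lowering Γ x := by
  ext y z
  rw [lowering_apply, lowering_apply, flatDeleted_dist hc, flatDeleted_dist hc]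
  refine if_congr ?_ rfl rfl
  rw [dist_eq_one_iff_adj, dist_eq_one_iff_adj]
  exact ⟨fun h => ⟨h.1.1, h.2⟩, fun h => ⟨⟨h.1, by lia⟩, h.2⟩⟩

theorem dist_le_eccNat [Finite X] (hc : Γ.Connected) (y : X) : Γ.dist x y ≤ Γ.eccNat x := by
  have : Nonempty X := ⟨x⟩
  have htop : Γ.eccent x ≠ ⊤ :=
    ne_top_of_le_ne_top (connected_iff_ediam_ne_top.1 hc) eccent_le_ediam
  exact ENat.toNat_le_toNat edist_le_eccent htop

variable [Fintype X]

open Classical in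
theorem dualIdempotent_mul_adjMatrix_mul_apply (i j : ℕ) (y z : X) :
    (Γ.dualIdempotent x i * Γ.adjMatrix ℂ * Γ.dualIdempotent x j) y z =
      if Γ.dist x y = i ∧ Γ.dist y z = 1 ∧ Γ.dist x z = j then 1 else 0 := by
  simp only [dualIdempotent, mul_diagonal, diagonal_mul, adjMatrix_apply, ite_zero_mul_ite_zero,
    dist_eq_one_iff_adj, and_assoc, one_mul]

open Classical in
theorem loweringMatrix_eq_lowering (hc : Γ.Connected) : Γ.loweringMatrix x = lowering Γ x := by
  ext y z
  have hentry : ∀ i ∈ Icc 1 (Γ.eccNat x),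
      (Γ.dualIdempotent x (i - 1) * Γ.adjMatrix ℂ * Γ.dualIdempotent x i) y z =
        if Γ.dist x z = i then lowering Γ x y z else 0 := fun i hi => by
    have := (mem_Icc.1 hi).1
    rw [dualIdempotent_mul_adjMatrix_mul_apply, lowering_apply, ← ite_and]
    exact if_congr (by lia) rfl rfl
  rw [loweringMatrix, Matrix.sum_apply, sum_congr rfl hentry, sum_ite_eq, ite_eq_left_iff]
  refine fun hz => (lowering_eq_zero fun h => hz ?_).symm
  exact mem_Icc.2 ⟨by lia, dist_le_eccNat hc z⟩

open Classical in
theorem raisingMatrix_eq_transpose_lowering (hc : Γ.Connected) :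
    Γ.raisingMatrix x = (lowering Γ x)ᵀ := by
  ext y z
  have hentry (i : ℕ) : (Γ.dualIdempotent x (i + 1) * Γ.adjMatrix ℂ * Γ.dualIdempotent x i) y z =
      if Γ.dist x z = i then lowering Γ x z y else 0 := by
    rw [dualIdempotent_mul_adjMatrix_mul_apply, lowering_apply, ← ite_and, dist_comm (u := z)]
    exact if_congr (by lia) rfl rfl
  rw [raisingMatrix, Matrix.sum_apply, transpose_apply]
  simp only [hentry]
  rw [sum_ite_eq, ite_eq_left_iff]
  refine fun hz => (lowering_eq_zero fun h => hz ?_).symm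
  have := dist_le_eccNat hc (x := x) y
  exact mem_range.2 (by lia)

open Classical in
theorem dualIdempotent_mulVec {i : ℕ} {v : X → ℂ} (hv : v ∈ subconstituent Γ x i) :
    Γ.dualIdempotent x i *ᵥ v = v := by
  ext t
  rw [dualIdempotent, mulVec_diagonal, ite_mul, one_mul, zero_mul]
  exact ite_eq_left_iff.2 fun ht => (mem_subconstituent.1 hv t ht).symm

theorem uniformRelation_of_isUniformStructure (hc : Γ.Connected) {U : Matrix ℕ ℕ ℂ} {f : ℕ → ℂ}
    (h : (Γ.flatDeleted x).IsUniformStructure x U f) {i : ℕ}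
    (hi : i ∈ Icc 1 ((Γ.flatDeleted x).eccNat x)) :
    UniformRelation (lowering Γ x) (lowering Γ x)ᵀ (subconstituent Γ x i) (eMinus U i)
      (ePlus ((Γ.flatDeleted x).eccNat x) U i) (f i) := by
  have hc' := flatDeleted_connected hc (x := x)
  intro w hw
  have hw' : w ∈ subconstituent (Γ.flatDeleted x) x i := by
    simpa only [mem_subconstituent, flatDeleted_dist hc] using hw
  have hrel := h.2 i hi w
  rwa [dualIdempotent_mulVec hw', loweringMatrix_eq_lowering hc',
    raisingMatrix_eq_transpose_lowering hc', lowering_flatDeleted hc] at hrel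

end FlatDeleted

section NearPolygon

variable {X : Type*} {Γ : SimpleGraph X} {q α β : ℝ}

theorem KiteFree.not_isIndContained (hc : Γ.Connected) (hk : KiteFree Γ 2) :
    ¬ K112.IsIndContained Γ := by
  rintro ⟨φ⟩
  let a : Σ i : Fin 3, Fin (![1, 1, 2] i) := ⟨0, (0 : Fin 1)⟩
  let b : Σ i : Fin 3, Fin (![1, 1, 2] i) := ⟨1, (0 : Fin 1)⟩
  let c : Σ i : Fin 3, Fin (![1, 1, 2] i) := ⟨2, (0 : Fin 2)⟩
  let d : Σ i : Fin 3, Fin (![1, 1, 2] i) := ⟨2, (1 : Fin 2)⟩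
  have hadj {u v : Σ i : Fin 3, Fin (![1, 1, 2] i)} : Γ.dist (φ u) (φ v) = 1 ↔ u.1 ≠ v.1 := by
    rw [dist_eq_one_iff_adj]
    exact φ.map_adj_iff
  have hcd₁ : Γ.dist (φ c) (φ d) ≠ 1 := fun h => hadj.1 h rfl
  have hcd₀ := hc.pos_dist_of_ne (φ.injective.ne (by decide : c ≠ d))
  have hca : Γ.dist (φ c) (φ a) = 1 := hadj.2 (by decide)
  have had : Γ.dist (φ a) (φ d) = 1 := hadj.2 (by decide)
  have hcd : Γ.dist (φ c) (φ d) = 2 := by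
    have := hc.dist_triangle (u := φ c) (v := φ a) (w := φ d)
    lia
  have hda : Γ.dist (φ d) (φ a) = 1 := hadj.2 (by decide)
  have hcb : Γ.dist (φ c) (φ b) = 1 := hadj.2 (by decide)
  have hdb : Γ.dist (φ d) (φ b) = 1 := hadj.2 (by decide)
  have hab : Γ.dist (φ a) (φ b) = 1 := hadj.2 (by decide)
  exact hk hcd hca (by rw [hda]) hcb (by rw [hdb]) hab

variable [Fintype X]

theorem drgA_two_ne_of_not_isNearPolygon (h : Γ.HasClassicalParameters Γ.diam q α β) (hq : q < -1)
    (hD : 3 ≤ Γ.diam) (hnp : ¬ Γ.IsNearPolygon) : Γ.drgA 2 ≠ Γ.drgA 1 * Γ.drgC 2 := fun h2 =>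
  hnp ⟨h.1, fun _ hi hi' => drgA_eq_of_drgA_two_eq h hq (by lia) h2 hi (by lia),
    ((kiteFree_three h hq hD).of_succ h.1 (by lia)).not_isIndContained h.1.1⟩

end NearPolygon

end DistanceRegularGraph

open DistanceRegularGraph in
theorem theorem6p3 {X : Type*} [Fintype X] (Γ : SimpleGraph X)
    (hΓ : Γ.IsDistanceRegular) (hD : 3 ≤ Γ.diam) (hneg : Γ.IsOfNegativeType)
    (ha₁ : Γ.drgA 1 ≠ 0) (hnp : ¬ Γ.IsNearPolygon) (x : X) :
    ¬ Γ.SupportsUniformStructure x := by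
  rintro ⟨U, f, hUf⟩
  obtain ⟨q, α, β, hq, h⟩ := hneg
  obtain ⟨y, hxy⟩ := exists_dist_eq hΓ x hD
  have hε : 3 ≤ (Γ.flatDeleted x).eccNat x := by
    rw [← hxy, ← flatDeleted_dist hΓ.1]
    exact dist_le_eccNat (flatDeleted_connected hΓ.1) y
  have hrel := uniformRelation_of_isUniformStructure hΓ.1 hUf
    (Finset.mem_Icc.2 ⟨one_le_two, by lia⟩)
  have hplus := hrel.right_coeff_eq_zero h hq hD (drgA_two_ne_of_not_isNearPolygon h hq hD hnp)
  rw [hplus] at hrel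
  have hminus := hrel.left_coeff_eq_zero hΓ hD ((kiteFree_three h hq hD).of_succ hΓ (by lia)) ha₁
  rw [SimpleGraph.ePlus, if_pos hε] at hplus
  rw [SimpleGraph.eMinus, if_pos le_rfl] at hminus
  obtain hlower | hupper := hUf.1.offDiag
  · exact hlower 2 (Finset.mem_Icc.2 ⟨le_rfl, by lia⟩) hminus
  · exact hupper 3 (Finset.mem_Icc.2 ⟨by decide, hε⟩) hplus
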